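/- Let $n\ge 2$, let $\Omega\subset\mathbb R^n$ be a bounded domain (a nonempty connected open set) with $\mathcal C^2$ boundary, let $0<T<\infty$, and set $Q=(0,T)\times\Omega$ and $\Box=\partial_t^2-\Delta_x$. Let $\xi\in\mathbb R^{1+n}$ and $M\ge 0$. Then there exist constants $C>0$ and $\lambda_0>1$, depending only on $\Omega$, $T$, $\xi$ and $M$, such that the following holds. For every $\omega\in\mathbb S^{n-1}=\{y\in\mathbb R^n:\ |y|=1\}$ with $\xi\cdot(1,-\omega)=0$, every real-valued $q\in L^\infty(Q)$ with $\|q\|_{L^\infty(Q)}\le M$, and every $\lambda\ge\lambda_0$, the equation $$\partial_t^2u-\Delta_xu+q(t,x)u=0\quad\text{in } Q,$$ understood in the sense of distributions on $Q$, that is, $\int_Q u\,(\Box\varphi+q\varphi)\,dt\,dx=0$ for all $\varphi\in\mathcal C_0^\infty(Q;\mathbb C)$, has a complex-valued solution $u\in H^1(Q)$ of the form $$u(t,x)=e^{-\lambda(t+x\cdot\omega)}\left(e^{-i\xi\cdot(t,x)}+w(t,x)\right),\quad (t,x)\in Q,$$ where $w\in H^1(Q)$ satisfies $$\|w\|_{H^k(Q)}\le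 C\lambda^{k-1},\quad k=0,1.$$ Here $H^0(Q)=L^2(Q)$ and $\|w\|_{H^1(Q)}^2=\|w\|_{L^2(Q)}^2+\|\partial_tw\|_{L^2(Q)}^2+\sum_{i=1}^n\|\partial_{x_i}w\|_{L^2(Q)}^2$, with weak derivatives. -/

import Mathlib

open MeasureTheory Topology
open scoped Distributions LineDeriv NNReal ENNReal

/-- The space variable `x ∈ ℝⁿ`, with its Euclidean structure. -/
abbrev Space (n : ℕ) : Type := EuclideanSpace ℝ (Fin n)

/-- Space-time `ℝ^{1+n}`, with points `z = (t, x)`. Its `volume` is Lebesgue measure `dt dx`. -/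
abbrev SpaceTime (n : ℕ) : Type := ℝ × Space n

/-- The `1 + n` coordinate directions of space-time: `none` is the direction of `t`, and
`some i` is the direction of `x_i`. -/
noncomputable def coordDir {n : ℕ} : Option (Fin n) → SpaceTime n
  | none => (1, 0)
  | some i => (0, EuclideanSpace.single i 1)

/-- `Ω` is a `C²` bounded domain of `ℝⁿ`: a nonempty bounded connected open set such that, near
each of its boundary points, `Ω` is the sublevel set `{ρ < 0}` of a `C²` function `ρ` with
nonvanishing differential. -/
structure IsC2BoundedDomain {n : ℕ} (Ω : TopologicalSpace.Opens (Space n)) : Prop where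
  isConnected : IsConnected (Ω : Set (Space n))
  isBounded : Bornology.IsBounded (Ω : Set (Space n))
  boundary : ∀ x₀ ∈ frontier (Ω : Set (Space n)),
    ∃ (U : Set (Space n)) (ρ : Space n → ℝ), IsOpen U ∧ x₀ ∈ U ∧ ContDiffOn ℝ 2 ρ U ∧
      (∀ x ∈ U, fderiv ℝ ρ x ≠ 0) ∧ ∀ x ∈ U, (x ∈ Ω ↔ ρ x < 0)

/-- The space-time cylinder `Q = (0, T) × Ω`. -/
def spaceTimeCylinder {n : ℕ} (T : ℝ) (Ω : TopologicalSpace.Opens (Space n)) :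
    TopologicalSpace.Opens (SpaceTime n) :=
  ⟨Set.Ioo 0 T ×ˢ (Ω : Set (Space n)), isOpen_Ioo.prod Ω.isOpen⟩

section Sobolev

variable {n : ℕ} (Q : TopologicalSpace.Opens (SpaceTime n))

/-- `g` is the weak derivative of `f` on `Q` in the direction `v`:
both are locally integrable on `Q` and `∫_Q f ∂_v φ = - ∫_Q g φ` for every test function `φ`. -/
def HasWeakDeriv (v : SpaceTime n) (f g : SpaceTime n → ℂ) : Prop :=
  LocallyIntegrableOn f Q ∧ LocallyIntegrableOn g Q ∧
    ∀ φ : 𝓓(Q, ℂ), ∫ z in Q, f z * (∂_{v} φ) z = - ∫ z in Q, g z * φ z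

/-- The (extended) norm of `L²(Q) = H⁰(Q)`. -/
noncomputable def normL2 (f : SpaceTime n → ℂ) : ℝ≥0∞ :=
  eLpNorm f 2 (volume.restrict Q)

/-- The `L²(Q)` norm of the weak derivative of `f` in the direction `v`, and `∞` if `f` has no
such weak derivative. (Weak derivatives are unique almost everywhere, so that the infimum runs over
at most one value: see `normL2WeakDeriv_eq`.) -/
noncomputable def normL2WeakDeriv (v : SpaceTime n) (f : SpaceTime n → ℂ) : ℝ≥0∞ :=
  ⨅ (g : SpaceTime n → ℂ) (_ : HasWeakDeriv Q v f g), normL2 Q g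

/-- The (extended) norm of `H¹(Q)`:
`‖f‖_{H¹}² = ‖f‖_{L²}² + ‖∂_t f‖_{L²}² + ∑ i, ‖∂_{x_i} f‖_{L²}²`. -/
noncomputable def normH1 (f : SpaceTime n → ℂ) : ℝ≥0∞ :=
  (normL2 Q f ^ 2 + ∑ j : Option (Fin n), normL2WeakDeriv Q (coordDir j) f ^ 2) ^ (1 / 2 : ℝ)

/-- `f ∈ H¹(Q)`: `f` and all its first-order weak partial derivatives are in `L²(Q)`. -/
def MemH1 (f : SpaceTime n → ℂ) : Prop :=
  MemLp f 2 (volume.restrict Q) ∧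
    ∀ j : Option (Fin n), ∃ g : SpaceTime n → ℂ,
      MemLp g 2 (volume.restrict Q) ∧ HasWeakDeriv Q (coordDir j) f g

variable {Q}

theorem HasWeakDeriv.ae_eq {v : SpaceTime n} {f g h : SpaceTime n → ℂ}
    (hg : HasWeakDeriv Q v f g) (hh : HasWeakDeriv Q v f h) :
    g =ᵐ[volume.restrict Q] h := by
  have key : ∀ᵐ z, z ∈ (Q : Set (SpaceTime n)) → (g - h) z = 0 := by
    refine Q.isOpen.ae_eq_zero_of_integral_contDiff_smul_eq_zero (hg.2.1.sub hh.2.1) ?_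
    intro ψ hψ hc hs
    have hs' : tsupport (fun z => (ψ z : ℂ)) ⊆ tsupport ψ :=
      closure_mono fun z hz h0 => hz (by simp [h0])
    let φ : 𝓓(Q, ℂ) := ⟨fun z => (ψ z : ℂ), Complex.ofRealCLM.contDiff.comp hψ,
      hc.comp_left (g := fun r : ℝ => (r : ℂ)) Complex.ofReal_zero,
      hs'.trans hs⟩
    have int : ∀ k : SpaceTime n → ℂ, LocallyIntegrableOn k (Q : Set (SpaceTime n)) →
        Integrable (fun z => ψ z • k z) volume := by
      intro k hk
      have h1 : IntegrableOn k (tsupport ψ) volume := hk.integrableOn_compact_subset hs hc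
      have h2 : IntegrableOn (fun z => ψ z • k z) (tsupport ψ) volume :=
        h1.continuousOn_smul hψ.continuous.continuousOn hc
      refine (integrableOn_iff_integrable_of_support_subset ?_).1 h2
      exact (Function.support_smul_subset_left _ _).trans (subset_tsupport ψ)
    have res : ∀ k : SpaceTime n → ℂ, ∫ z in Q, k z * φ z = ∫ z, ψ z • k z := by
      intro k
      have hz : ∀ z, z ∉ (Q : Set (SpaceTime n)) → ψ z • k z = 0 := by
        intro z hz
        rw [image_eq_zero_of_notMem_tsupport (fun h => hz (hs h)), zero_smul]
      rw [← setIntegral_eq_integral_of_forall_compl_eq_zero hz]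
      refine integral_congr_ae (Filter.Eventually.of_forall fun z => ?_)
      change k z * (ψ z : ℂ) = ψ z • k z
      rw [Complex.real_smul, mul_comm]
    have e : ∫ z, ψ z • g z = ∫ z, ψ z • h z := by
      rw [← res g, ← res h]
      exact neg_injective ((hg.2.2 φ).symm.trans (hh.2.2 φ))
    simp only [Pi.sub_apply, smul_sub]
    rw [integral_sub (int g hg.2.1) (int h hh.2.1), e, sub_self]
  refine (ae_restrict_iff' Q.isOpen.measurableSet).2 (key.mono fun z hz hzQ => ?_)
  exact sub_eq_zero.1 (hz hzQ)

theorem normL2WeakDeriv_eq {v : SpaceTime n} {f g : SpaceTime n → ℂ}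
    (hg : HasWeakDeriv Q v f g) : normL2WeakDeriv Q v f = normL2 Q g :=
  le_antisymm (iInf₂_le g hg)
    (le_iInf₂ fun _ hh => (eLpNorm_congr_ae (hg.ae_eq hh)).le)

variable (Q)

/-- The wave operator `□ = ∂_t² - Δ_x` on test functions. -/
noncomputable def waveOp (φ : 𝓓(Q, ℂ)) : 𝓓(Q, ℂ) :=
  ∂_{(coordDir none : SpaceTime n)} (∂_{(coordDir none : SpaceTime n)} φ) -
    ∑ i : Fin n, ∂_{(coordDir (some i) : SpaceTime n)} (∂_{(coordDir (some i) : SpaceTime n)} φ)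

/-- `u` solves `∂_t² u - Δ_x u + q u = 0` on `Q` in the sense of distributions (no boundary
conditions): `∫_Q u (□φ + qφ) = 0` for every test function `φ` on `Q`. -/
def IsWeakSolution (q : SpaceTime n → ℝ) (u : SpaceTime n → ℂ) : Prop :=
  ∀ φ : 𝓓(Q, ℂ), ∫ z in Q, u z * (waveOp Q φ z + (q z : ℂ) * φ z) = 0

end Sobolev

/-! Since `|ω| = 1`, the phase `t + x⬝ω` is light-like, and conjugating `□` with `e^{-lam (t +
x⬝ω)}` gives `P = □ - 2 lam (∂_t - ω⬝∇)`, with no zeroth-order term. Since `ξ` is orthogonal to `(1,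
-ω)`, the first-order part of `P` kills the plane wave. So `w` must solve `P w + q w = -(μ + q)
e^{-iξ⬝z}` with `μ = waveEigenvalue ξ`, and the right-hand side is bounded in `L²(Q)` independently
of `lam`. No boundary condition is imposed, so one may extend by zero from `Q` and invert `P` in the
whole space. It is enough to do so with norm `T / lam` on `L²` and `O(1)` from `L²` to `H¹`: the
potential is then absorbed by a contraction (`exists_fixedPoint_lpMultiplier`).

After a Fourier transform in `x`, `P` is `∂_t² - 2 lam ∂_t + c(η)`, which is a damped oscillator
when time runs backwards. With `k` its solution such that `k(0) = 0` and `k'(0) = 1`, put `w(t) =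
∫₀ᵀ k(r) f(t + r) dr`, whose multiplier in space-time is `∫₀ᵀ k(r) e^{sr} dr`. The energy `|k' + lam
k|² + L² |k|²` with `L² = |2πη|² + lam²` does not increase (`dampedEnergy_le_one`,
`spatialSymbol_bound`), so `|k| ≤ 1/L` and `|k'| ≤ 2`. This bounds the multiplier by `T / lam` and
its products with the symbols of the first derivatives by constants.

Cutting the integral at `T` leaves an error built from `f(t + T)` and operators acting in `x` only.
It vanishes for `t > 0` when `f` is supported in `t < T`, so `P w = f` holds on `Q`
(`integral_conjugatedWaveAdjoint_mul_lpMultiplier`). -/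

/-! ### The damped oscillator and its energy estimate -/

/-- The square root `κ` of `c - lam²` which is the frequency of the damped oscillations
`k'' + 2 lam k' + c k = 0`. -/
noncomputable def dampedFrequency (lam : ℝ) (c : ℂ) : ℂ := (c - lam ^ 2) ^ (((2 : ℕ) : ℂ)⁻¹)

/-- The solution of `k'' + 2 lam k' + c k = 0`, `k 0 = 0`, `k' 0 = 1`. -/
noncomputable def dampedSine (lam : ℝ) (c : ℂ) (r : ℝ) : ℂ :=
  Complex.exp (-lam * r) * (if dampedFrequency lam c = 0 then (r : ℂ) else
    Complex.sin (dampedFrequency lam c * r) / dampedFrequency lam c)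

/-- The function `k' + lam k`, where `k` is `dampedSine lam c`. -/
noncomputable def dampedCosine (lam : ℝ) (c : ℂ) (r : ℝ) : ℂ :=
  Complex.exp (-lam * r) * Complex.cos (dampedFrequency lam c * r)

theorem dampedFrequency_sq (lam : ℝ) (c : ℂ) : dampedFrequency lam c ^ 2 = c - lam ^ 2 :=
  Complex.cpow_nat_inv_pow _ two_ne_zero

@[simp]
theorem dampedSine_zero (lam : ℝ) (c : ℂ) : dampedSine lam c 0 = 0 := by
  simp [dampedSine]

@[simp]
theorem dampedCosine_zero (lam : ℝ) (c : ℂ) : dampedCosine lam c 0 = 1 := by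
  simp [dampedCosine]

theorem hasDerivAt_exp_ofReal_mul (a : ℂ) (r : ℝ) :
    HasDerivAt (fun r : ℝ => Complex.exp (a * r)) (a * Complex.exp (a * r)) r := by
  have h : HasDerivAt (fun z : ℂ => Complex.exp (a * z)) (Complex.exp (a * r) * (a * 1)) (r : ℂ) :=
    ((hasDerivAt_id' (r : ℂ)).const_mul a).cexp
  convert h.comp_ofReal using 1
  ring

theorem hasDerivAt_dampedSine (lam : ℝ) (c : ℂ) (r : ℝ) :
    HasDerivAt (dampedSine lam c) (dampedCosine lam c r - lam * dampedSine lam c r) r := by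
  have h1 := hasDerivAt_exp_ofReal_mul (-lam) r
  have h2 : HasDerivAt (fun r : ℝ => if dampedFrequency lam c = 0 then (r : ℂ) else
      Complex.sin (dampedFrequency lam c * r) / dampedFrequency lam c)
      (Complex.cos (dampedFrequency lam c * r)) r := by
    by_cases h : dampedFrequency lam c = 0
    · simpa [h] using (hasDerivAt_id' (r : ℂ)).comp_ofReal
    · simp only [h, if_false]
      have h3 : HasDerivAt (fun z : ℂ => Complex.sin (dampedFrequency lam c * z))
          (Complex.cos (dampedFrequency lam c * r) * (dampedFrequency lam c * 1)) (r : ℂ) :=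
        ((hasDerivAt_id' (r : ℂ)).const_mul _).csin
      convert (h3.div_const (dampedFrequency lam c)).comp_ofReal using 1
      field_simp
  refine (h1.mul h2).congr_deriv ?_
  simp only [dampedSine, dampedCosine]
  ring

theorem hasDerivAt_dampedCosine (lam : ℝ) (c : ℂ) (r : ℝ) :
    HasDerivAt (dampedCosine lam c)
      (-lam * dampedCosine lam c r + (lam ^ 2 - c) * dampedSine lam c r) r := by
  have h1 := hasDerivAt_exp_ofReal_mul (-lam) r
  have h3 : HasDerivAt (fun z : ℂ => Complex.cos (dampedFrequency lam c * z))
      (-Complex.sin (dampedFrequency lam c * r) * (dampedFrequency lam c * 1)) (r : ℂ) :=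
    ((hasDerivAt_id' (r : ℂ)).const_mul _).ccos
  refine (h1.mul h3.comp_ofReal).congr_deriv ?_
  have hk := dampedFrequency_sq lam c
  rw [show (lam : ℂ) ^ 2 - c = -dampedFrequency lam c ^ 2 by rw [hk]; ring]
  simp only [dampedSine, dampedCosine]
  split_ifs with h
  · simp [h]
  · field_simp

theorem continuous_dampedSine (lam : ℝ) (c : ℂ) : Continuous (dampedSine lam c) :=
  continuous_iff_continuousAt.2 fun r => (hasDerivAt_dampedSine lam c r).continuousAt

theorem continuous_dampedCosine (lam : ℝ) (c : ℂ) : Continuous (dampedCosine lam c) :=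
  continuous_iff_continuousAt.2 fun r => (hasDerivAt_dampedCosine lam c r).continuousAt

/-- The energy of the damped oscillations is nonincreasing. -/
theorem dampedEnergy_le_one {lam L : ℝ} {c : ℂ} (hlam : 0 ≤ lam)
    (h : ‖(lam : ℂ) ^ 2 - c + L ^ 2‖ ≤ 2 * lam * L) {r : ℝ} (hr : 0 ≤ r) :
    ‖dampedCosine lam c r‖ ^ 2 + L ^ 2 * ‖dampedSine lam c r‖ ^ 2 ≤ 1 := by
  set k := dampedSine lam c
  set j := dampedCosine lam c
  have hd : ∀ r, HasDerivAt (fun r => ‖j r‖ ^ 2 + L ^ 2 * ‖k r‖ ^ 2)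
      (2 * inner ℝ (j r) (-lam * j r + (lam ^ 2 - c) * k r) +
        L ^ 2 * (2 * inner ℝ (k r) (j r - lam * k r))) r := fun r =>
    (hasDerivAt_dampedCosine lam c r).norm_sq.add
      ((hasDerivAt_dampedSine lam c r).norm_sq.const_mul _)
  have hanti : Antitone fun r => ‖j r‖ ^ 2 + L ^ 2 * ‖k r‖ ^ 2 := by
    refine antitone_of_deriv_nonpos (fun r => (hd r).differentiableAt) fun r => ?_
    rw [(hd r).deriv]
    -- The damping contributes exactly `-2 lam` times the energy. By the hypothesis on `c`, the
    -- cross term is at most `4 lam L ‖j‖ ‖k‖`, so the derivative is at most `-2 lam (‖j‖ - L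
    -- ‖k‖)²`.
    have e1 : (2 * inner ℝ (j r) (-lam * j r + (lam ^ 2 - c) * k r) +
        L ^ 2 * (2 * inner ℝ (k r) (j r - lam * k r)) : ℝ) =
        2 * inner ℝ (j r) (((lam : ℂ) ^ 2 - c + L ^ 2) * k r) -
          2 * lam * (‖j r‖ ^ 2 + L ^ 2 * ‖k r‖ ^ 2) := by
      have e2 : (-lam * j r + (lam ^ 2 - c) * k r : ℂ) =
          ((lam : ℂ) ^ 2 - c + L ^ 2) * k r - lam • j r - (L ^ 2) • k r := by
        simp only [Complex.real_smul]; push_cast; ring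
      have e3 : (j r - lam * k r : ℂ) = j r - lam • k r := by simp
      rw [e2, e3, inner_sub_right, inner_sub_right, inner_sub_right, inner_smul_right,
        inner_smul_right, inner_smul_right, real_inner_self_eq_norm_sq, real_inner_self_eq_norm_sq,
        real_inner_comm (j r) (k r)]
      ring
    rw [e1]
    have h1 : inner ℝ (j r) (((lam : ℂ) ^ 2 - c + L ^ 2) * k r) ≤
        ‖j r‖ * (2 * lam * L * ‖k r‖) := by
      refine (real_inner_le_norm _ _).trans ?_
      rw [norm_mul]
      gcongr
    nlinarith [mul_nonneg hlam (sq_nonneg (‖j r‖ - L * ‖k r‖))]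
  simpa [j, k] using hanti hr

theorem norm_dampedSine_le {lam L : ℝ} {c : ℂ} (hlam : 0 ≤ lam)
    (h : ‖(lam : ℂ) ^ 2 - c + L ^ 2‖ ≤ 2 * lam * L) {r : ℝ} (hr : 0 ≤ r) :
    L * ‖dampedSine lam c r‖ ≤ 1 := by
  refine le_of_sq_le_sq ?_ one_pos.le
  nlinarith [dampedEnergy_le_one hlam h hr, sq_nonneg ‖dampedCosine lam c r‖]

theorem norm_dampedCosine_le {lam L : ℝ} {c : ℂ} (hlam : 0 ≤ lam)
    (h : ‖(lam : ℂ) ^ 2 - c + L ^ 2‖ ≤ 2 * lam * L) {r : ℝ} (hr : 0 ≤ r) :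
    ‖dampedCosine lam c r‖ ≤ 1 := by
  refine le_of_sq_le_sq ?_ one_pos.le
  nlinarith [dampedEnergy_le_one hlam h hr, sq_nonneg (L * ‖dampedSine lam c r‖)]

/-! ### Truncated Laplace transform of the damped sine -/

/-- The integral of `exp (s r)` against the damped sine. -/
noncomputable def truncatedLaplace (T lam : ℝ) (c s : ℂ) : ℂ :=
  ∫ r in (0 : ℝ)..T, dampedSine lam c r * Complex.exp (s * r)

/-- Two integrations by parts, done at once through an explicit antiderivative. The endpoint `0`
gives the `1`, so that the transform inverts the symbol; the endpoint `T` gives the truncation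
error, which carries the factor `exp (s T)` of a translation in time. -/
theorem truncatedLaplace_symbol_mul (T lam : ℝ) (c s : ℂ) :
    (s ^ 2 - 2 * lam * s + c) * truncatedLaplace T lam c s = 1 + Complex.exp (s * T) *
      (s * dampedSine lam c T - (dampedCosine lam c T + lam * dampedSine lam c T)) := by
  rw [truncatedLaplace, ← intervalIntegral.integral_const_mul]
  have hd : ∀ r ∈ Set.uIcc 0 T, HasDerivAt (fun r : ℝ => Complex.exp (s * r) *
      (s * dampedSine lam c r - (dampedCosine lam c r + lam * dampedSine lam c r)))
      ((s ^ 2 - 2 * lam * s + c) * (dampedSine lam c r * Complex.exp (s * r))) r := by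
    intro r _
    have hk := hasDerivAt_dampedSine lam c r
    refine ((hasDerivAt_exp_ofReal_mul s r).mul ((hk.const_mul s).sub
      ((hasDerivAt_dampedCosine lam c r).add (hk.const_mul (lam : ℂ))))).congr_deriv ?_
    simp only [Pi.sub_apply, Pi.add_apply]
    ring
  rw [intervalIntegral.integral_eq_sub_of_hasDerivAt hd]
  · simp
    ring
  · have := continuous_dampedSine lam c
    exact Continuous.intervalIntegrable (by fun_prop) _ _

/-- One integration by parts moves `s` onto the oscillator, whose derivative is bounded uniformly in
the frequency. This is what controls the time derivative. -/
theorem truncatedLaplace_mul (T lam : ℝ) (c s : ℂ) :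
    s * truncatedLaplace T lam c s = dampedSine lam c T * Complex.exp (s * T) -
      ∫ r in (0 : ℝ)..T, (dampedCosine lam c r - lam * dampedSine lam c r) *
        Complex.exp (s * r) := by
  have hk := continuous_dampedSine lam c
  have hj := continuous_dampedCosine lam c
  have hd : ∀ r ∈ Set.uIcc 0 T, HasDerivAt (fun r : ℝ => dampedSine lam c r * Complex.exp (s * r))
      (s * (dampedSine lam c r * Complex.exp (s * r)) +
        (dampedCosine lam c r - lam * dampedSine lam c r) * Complex.exp (s * r)) r := by
    intro r _
    refine ((hasDerivAt_dampedSine lam c r).mul (hasDerivAt_exp_ofReal_mul s r)).congr_deriv ?_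
    ring
  have h := intervalIntegral.integral_eq_sub_of_hasDerivAt hd
    (Continuous.intervalIntegrable (by fun_prop) _ _)
  rw [intervalIntegral.integral_add (Continuous.intervalIntegrable (by fun_prop) _ _)
    (Continuous.intervalIntegrable (by fun_prop) _ _), intervalIntegral.integral_const_mul] at h
  rw [truncatedLaplace, eq_sub_iff_add_eq, h]
  simp

theorem norm_exp_mul_ofReal_of_re_eq_zero {s : ℂ} (hs : s.re = 0) (r : ℝ) :
    ‖Complex.exp (s * r)‖ = 1 := by
  simp [Complex.norm_exp, hs]

theorem norm_truncatedLaplace_le {T lam L : ℝ} {c s : ℂ} (hT : 0 ≤ T) (hlam : 0 ≤ lam)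
    (hL : 0 < L) (h : ‖(lam : ℂ) ^ 2 - c + L ^ 2‖ ≤ 2 * lam * L) (hs : s.re = 0) :
    L * ‖truncatedLaplace T lam c s‖ ≤ T := by
  have h1 : ‖truncatedLaplace T lam c s‖ ≤ L⁻¹ * |T - 0| := by
    refine intervalIntegral.norm_integral_le_of_norm_le_const fun r hr => ?_
    rw [Set.uIoc_of_le hT] at hr
    rw [norm_mul, norm_exp_mul_ofReal_of_re_eq_zero hs, mul_one, ← one_div, le_div_iff₀' hL]
    exact norm_dampedSine_le hlam h hr.1.le
  rw [sub_zero, abs_of_nonneg hT] at h1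
  calc L * ‖truncatedLaplace T lam c s‖ ≤ L * (L⁻¹ * T) := by gcongr
    _ = T := by field_simp

theorem norm_mul_truncatedLaplace_le {T lam L : ℝ} {c s : ℂ} (hT : 0 ≤ T) (hlam : 1 ≤ lam)
    (hL : lam ≤ L) (h : ‖(lam : ℂ) ^ 2 - c + L ^ 2‖ ≤ 2 * lam * L) (hs : s.re = 0) :
    ‖s * truncatedLaplace T lam c s‖ ≤ 1 + 2 * T := by
  have hlam0 : 0 ≤ lam := zero_le_one.trans hlam
  have hk : ∀ r, 0 ≤ r → lam * ‖dampedSine lam c r‖ ≤ 1 := fun r hr =>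
    (mul_le_mul_of_nonneg_right hL (norm_nonneg _)).trans (norm_dampedSine_le hlam0 h hr)
  have h1 : ‖∫ r in (0 : ℝ)..T, (dampedCosine lam c r - lam * dampedSine lam c r) *
      Complex.exp (s * r)‖ ≤ 2 * |T - 0| := by
    refine intervalIntegral.norm_integral_le_of_norm_le_const fun r hr => ?_
    rw [Set.uIoc_of_le hT] at hr
    rw [norm_mul, norm_exp_mul_ofReal_of_re_eq_zero hs, mul_one]
    refine (norm_sub_le _ _).trans ?_
    rw [norm_mul, Complex.norm_real, Real.norm_of_nonneg hlam0]
    linarith [hk r hr.1.le, norm_dampedCosine_le hlam0 h hr.1.le]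
  rw [sub_zero, abs_of_nonneg hT] at h1
  rw [truncatedLaplace_mul]
  refine (norm_sub_le _ _).trans (add_le_add ?_ h1)
  rw [norm_mul, norm_exp_mul_ofReal_of_re_eq_zero hs, mul_one]
  exact (le_mul_of_one_le_left (norm_nonneg _) hlam).trans (hk T hT)

/-- The principal branch jumps, so the frequency is only measurable in `c`; this suffices to define
an `L^∞` multiplier. -/
theorem measurable_dampedFrequency (lam : ℝ) : Measurable (dampedFrequency lam) := by
  unfold dampedFrequency
  fun_prop

theorem measurable_dampedSine (lam : ℝ) :
    Measurable fun p : ℂ × ℝ => dampedSine lam p.1 p.2 := by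
  have h : Measurable fun p : ℂ × ℝ => dampedFrequency lam p.1 :=
    (measurable_dampedFrequency lam).comp measurable_fst
  unfold dampedSine
  refine Measurable.mul (by fun_prop) (Measurable.ite (h (measurableSet_singleton 0))
    (by fun_prop) (by fun_prop))

theorem measurable_dampedCosine (lam : ℝ) :
    Measurable fun p : ℂ × ℝ => dampedCosine lam p.1 p.2 := by
  have h : Measurable fun p : ℂ × ℝ => dampedFrequency lam p.1 :=
    (measurable_dampedFrequency lam).comp measurable_fst
  unfold dampedCosine
  fun_prop

theorem measurable_truncatedLaplace (T lam : ℝ) :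
    Measurable fun p : ℂ × ℂ => truncatedLaplace T lam p.1 p.2 := by
  have h : StronglyMeasurable (Function.uncurry fun (p : ℂ × ℂ) (r : ℝ) =>
      dampedSine lam p.1 r * Complex.exp (p.2 * r)) := by
    refine Measurable.stronglyMeasurable ?_
    refine Measurable.mul ((measurable_dampedSine lam).comp
      (measurable_fst.fst.prodMk measurable_snd)) ?_
    fun_prop
  unfold truncatedLaplace intervalIntegral
  exact (h.integral_prod_right.sub h.integral_prod_right).measurable

/-! ### Symbols of the conjugated operator and bounds on its multiplier -/

section Symbol

variable {n : ℕ}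

/-- Space-time with its Euclidean norm. -/
abbrev EuclideanSpaceTime (n : ℕ) : Type := WithLp 2 (ℝ × Space n)

/-- The symbol of `-Δ + 2 lam ω ⬝ ∇`. -/
noncomputable def spatialSymbol (ω : Space n) (lam : ℝ) (η : Space n) : ℂ :=
  ((2 * Real.pi * ‖η‖) ^ 2 : ℝ) + 2 * lam * ((2 * Real.pi * inner ℝ η ω : ℝ) * Complex.I)

theorem measurable_spatialSymbol (ω : Space n) (lam : ℝ) :
    Measurable (spatialSymbol ω lam) := by
  have : Continuous (spatialSymbol ω lam) := by unfold spatialSymbol; fun_prop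
  exact this.measurable

/-- The symbol of `∂_t`. -/
noncomputable def timeSymbol (ζ : EuclideanSpaceTime n) : ℂ :=
  (2 * Real.pi * ζ.fst : ℝ) * Complex.I

/-- The symbol of `□ - 2 lam (∂_t - ω ⬝ ∇)`. -/
noncomputable def conjugatedWaveSymbol (ω : Space n) (lam : ℝ) (ζ : EuclideanSpaceTime n) : ℂ :=
  timeSymbol ζ ^ 2 - 2 * lam * timeSymbol ζ + spatialSymbol ω lam ζ.snd

/-- The Fourier multiplier of the truncated backward fundamental solution of
`□ - 2 lam (∂_t - ω ⬝ ∇)`. -/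
noncomputable def waveMultiplier (T : ℝ) (ω : Space n) (lam : ℝ) (ζ : EuclideanSpaceTime n) : ℂ :=
  truncatedLaplace T lam (spatialSymbol ω lam ζ.snd) (timeSymbol ζ)

/-- With this choice of `L` the terms `|2πη|²` cancel, leaving `2 lam (lam - 2πi η⬝ω)`.
Cauchy–Schwarz with `|ω| = 1` bounds its modulus by `2 lam L`, which is the hypothesis of the energy
estimate. -/
theorem spatialSymbol_bound {ω : Space n} (hω : ‖ω‖ = 1) {lam : ℝ} (hlam : 0 ≤ lam)
    (η : Space n) :
    ‖(lam : ℂ) ^ 2 - spatialSymbol ω lam η + (√((2 * Real.pi * ‖η‖) ^ 2 + lam ^ 2) : ℝ) ^ 2‖ ≤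
      2 * lam * √((2 * Real.pi * ‖η‖) ^ 2 + lam ^ 2) := by
  have e : (lam : ℂ) ^ 2 - spatialSymbol ω lam η +
      (√((2 * Real.pi * ‖η‖) ^ 2 + lam ^ 2) : ℝ) ^ 2 =
      (2 * lam : ℝ) * ((lam : ℝ) + (-(2 * Real.pi * inner ℝ η ω) : ℝ) * Complex.I) := by
    rw [← Complex.ofReal_pow (√_), Real.sq_sqrt (by positivity), spatialSymbol]
    push_cast
    ring
  rw [e, norm_mul, Complex.norm_add_mul_I, Complex.norm_real, Real.norm_of_nonneg (by positivity)]
  refine mul_le_mul_of_nonneg_left (Real.sqrt_le_sqrt ?_) (by positivity)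
  have h1 : |inner ℝ η ω| ≤ ‖η‖ := by simpa [hω] using abs_real_inner_le_norm η ω
  have h2 : (inner ℝ η ω) ^ 2 ≤ ‖η‖ ^ 2 := sq_le_sq' (abs_le.1 h1).1 (abs_le.1 h1).2
  nlinarith [mul_le_mul_of_nonneg_left h2 (sq_nonneg (2 * Real.pi))]

theorem timeSymbol_re (ζ : EuclideanSpaceTime n) : (timeSymbol ζ).re = 0 := by
  simp [timeSymbol]

theorem measurable_timeSymbol : Measurable (timeSymbol (n := n)) := by
  have : Continuous (timeSymbol (n := n)) := by unfold timeSymbol; fun_prop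
  exact this.measurable

theorem waveMultiplier_eq_comp (T : ℝ) (ω : Space n) (lam : ℝ) :
    waveMultiplier T ω lam = (fun p : ℂ × ℂ => truncatedLaplace T lam p.1 p.2) ∘
      fun ζ => (spatialSymbol ω lam ζ.snd, timeSymbol ζ) := by
  funext ζ
  rw [waveMultiplier, Function.comp_apply]

theorem measurable_waveMultiplier (T : ℝ) (ω : Space n) (lam : ℝ) :
    Measurable (waveMultiplier T ω lam) := by
  have h : Measurable fun ζ : EuclideanSpaceTime n => ζ.snd := by fun_prop
  rw [waveMultiplier_eq_comp]
  exact (measurable_truncatedLaplace T lam).comp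
    (((measurable_spatialSymbol ω lam).comp h).prodMk measurable_timeSymbol)

variable {ω : Space n} {lam T : ℝ}

theorem norm_waveMultiplier_le (hω : ‖ω‖ = 1) (hlam : 0 < lam) (hT : 0 ≤ T)
    (ζ : EuclideanSpaceTime n) : ‖waveMultiplier T ω lam ζ‖ ≤ T * lam⁻¹ := by
  have h := norm_truncatedLaplace_le (s := timeSymbol ζ) hT hlam.le (by positivity)
    (spatialSymbol_bound hω hlam.le ζ.snd) (timeSymbol_re ζ)
  rw [← div_eq_mul_inv, le_div_iff₀' hlam]
  refine le_trans ?_ h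
  exact mul_le_mul_of_nonneg_right (Real.le_sqrt_of_sq_le
    (by nlinarith [sq_nonneg (2 * Real.pi * ‖ζ.snd‖)])) (norm_nonneg _)

/-- The energy weight `L` dominates `2π|η|` as well as `lam`: one spatial derivative costs exactly
the gain `1 / lam`. -/
theorem norm_space_mul_waveMultiplier_le (hω : ‖ω‖ = 1) (hlam : 0 < lam) (hT : 0 ≤ T)
    (ζ : EuclideanSpaceTime n) : 2 * Real.pi * ‖ζ.snd‖ * ‖waveMultiplier T ω lam ζ‖ ≤ T := by
  have h := norm_truncatedLaplace_le (s := timeSymbol ζ) hT hlam.le (by positivity)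
    (spatialSymbol_bound hω hlam.le ζ.snd) (timeSymbol_re ζ)
  refine le_trans ?_ h
  exact mul_le_mul_of_nonneg_right (Real.le_sqrt_of_sq_le (by nlinarith)) (norm_nonneg _)

theorem norm_time_mul_waveMultiplier_le (hω : ‖ω‖ = 1) (hlam : 1 ≤ lam) (hT : 0 ≤ T)
    (ζ : EuclideanSpaceTime n) : ‖timeSymbol ζ * waveMultiplier T ω lam ζ‖ ≤ 1 + 2 * T :=
  norm_mul_truncatedLaplace_le hT hlam
    (Real.le_sqrt_of_sq_le (by nlinarith [sq_nonneg (2 * Real.pi * ‖ζ.snd‖)]))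
    (spatialSymbol_bound hω (by linarith) ζ.snd) (timeSymbol_re ζ)

end Symbol

/-! ### Fourier multipliers on `L²` and Fourier uniqueness -/

section FourierMultiplier

open FourierTransform SchwartzMap

variable {V : Type*} [NormedAddCommGroup V] [InnerProductSpace ℝ V] [FiniteDimensional ℝ V]
  [MeasurableSpace V] [BorelSpace V]

/-- Parseval in bilinear form, without conjugation; hence the inverse transform falls on the
Schwartz function. -/
theorem integral_mul_eq_integral_fourierInv_mul_fourier (φ : 𝓢(V, ℂ))
    (f : Lp ℂ 2 (volume : Measure V)) :
    ∫ z, φ z * f z = ∫ ζ, 𝓕⁻ φ ζ * (𝓕 f : Lp ℂ 2 (volume : Measure V)) ζ := by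
  have h := congrArg (fun u => u (𝓕⁻ φ)) (Lp.fourier_toTemperedDistribution_eq f)
  simpa only [TemperedDistribution.fourier_apply, Lp.toTemperedDistribution_apply, smul_eq_mul,
    fourier_fourierInv_eq] using h

theorem fourierInv_lineDerivOp_apply (φ : 𝓢(V, ℂ)) (v ζ : V) :
    𝓕⁻ (∂_{v} φ) ζ = -((2 * Real.pi * inner ℝ ζ v : ℝ) * Complex.I * 𝓕⁻ φ ζ) := by
  have : (inner ℝ · v).HasTemperateGrowth := by fun_prop
  rw [SchwartzMap.fourierInv_lineDerivOp_eq]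
  simp [this]
  ring

theorem fourierInv_compSubConst_apply (φ : 𝓢(V, ℂ)) (h ζ : V) :
    𝓕⁻ (compSubConstCLM ℂ h φ) ζ =
      Complex.exp ((2 * Real.pi * inner ℝ ζ h : ℝ) * Complex.I) * 𝓕⁻ φ ζ := by
  rw [fourierInv_coe, fourierInv_coe, Real.fourierInv_eq', Real.fourierInv_eq',
    ← integral_const_mul, ← integral_add_right_eq_self _ h]
  refine integral_congr_ae (.of_forall fun v => ?_)
  simp only [compSubConstCLM_apply, add_sub_cancel_right, smul_eq_mul]
  rw [inner_add_left, real_inner_comm ζ h, ← mul_assoc, ← Complex.exp_add]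
  congr 2
  push_cast
  ring

/-- The Fourier multiplier with symbol `σ ∈ L^∞` acting on `L²`. -/
noncomputable def lpMultiplier (σ : Lp ℂ ∞ (volume : Measure V))
    (f : Lp ℂ 2 (volume : Measure V)) : Lp ℂ 2 (volume : Measure V) :=
  𝓕⁻ (σ • (𝓕 f : Lp ℂ 2 (volume : Measure V)) : Lp ℂ 2 (volume : Measure V))

theorem norm_lpMultiplier_le (σ : Lp ℂ ∞ (volume : Measure V))
    (f : Lp ℂ 2 (volume : Measure V)) : ‖lpMultiplier σ f‖ ≤ ‖σ‖ * ‖f‖ := by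
  calc ‖lpMultiplier σ f‖ = ‖(σ • (𝓕 f : Lp ℂ 2 (volume : Measure V)) :
        Lp ℂ 2 (volume : Measure V))‖ := (Lp.fourierTransformₗᵢ V ℂ).symm.norm_map _
    _ ≤ ‖σ‖ * ‖(𝓕 f : Lp ℂ 2 (volume : Measure V))‖ := Lp.norm_smul_le _ _
    _ = ‖σ‖ * ‖f‖ := by rw [Lp.norm_fourier_eq]

theorem lpMultiplier_sub (σ : Lp ℂ ∞ (volume : Measure V))
    (f g : Lp ℂ 2 (volume : Measure V)) :
    lpMultiplier σ (f - g) = lpMultiplier σ f - lpMultiplier σ g := by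
  have e : (𝓕 (f - g) : Lp ℂ 2 (volume : Measure V)) = 𝓕 f + -𝓕 g := by
    rw [← sub_eq_add_neg]; exact (Lp.fourierTransformₗᵢ V ℂ).map_sub f g
  rw [lpMultiplier, e, Lp.add_smul, Lp.smul_neg, ← sub_eq_add_neg]
  exact (Lp.fourierTransformₗᵢ V ℂ).symm.map_sub _ _

theorem integral_mul_lpMultiplier (φ : 𝓢(V, ℂ)) (σ : Lp ℂ ∞ (volume : Measure V))
    (f : Lp ℂ 2 (volume : Measure V)) :
    ∫ z, φ z * lpMultiplier σ f z =
      ∫ ζ, 𝓕⁻ φ ζ * (σ ζ * (𝓕 f : Lp ℂ 2 (volume : Measure V)) ζ) := by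
  have e : (𝓕 (lpMultiplier σ f) : Lp ℂ 2 (volume : Measure V)) =
      (σ • (𝓕 f : Lp ℂ 2 (volume : Measure V)) : Lp ℂ 2 (volume : Measure V)) :=
    (Lp.fourierTransformₗᵢ V ℂ).apply_symm_apply _
  rw [integral_mul_eq_integral_fourierInv_mul_fourier, e]
  refine integral_congr_ae ?_
  filter_upwards [Lp.coeFn_lpSMul (r := 2) σ (𝓕 f : Lp ℂ 2 (volume : Measure V))] with ζ hζ
  rw [hζ, Pi.smul_apply', smul_eq_mul]

/-- If `σ' = 2πi ⟨·, v⟩ σ`, then `σ'(D) f` is the weak derivative of `σ(D) f` in direction `v`. -/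
theorem integral_lineDeriv_mul_lpMultiplier {σ σ' : Lp ℂ ∞ (volume : Measure V)} {v : V}
    (h : ∀ᵐ ζ, σ' ζ = (2 * Real.pi * inner ℝ ζ v : ℝ) * Complex.I * σ ζ) (φ : 𝓢(V, ℂ))
    (f : Lp ℂ 2 (volume : Measure V)) :
    ∫ z, ∂_{v} φ z * lpMultiplier σ f z = -∫ z, φ z * lpMultiplier σ' f z := by
  rw [integral_mul_lpMultiplier, integral_mul_lpMultiplier, ← integral_neg]
  refine integral_congr_ae ?_
  filter_upwards [h] with ζ hζ
  rw [hζ, fourierInv_lineDerivOp_apply]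
  ring

theorem integrable_schwartz_mul_lp (φ : 𝓢(V, ℂ)) (f : Lp ℂ 2 (volume : Measure V)) :
    Integrable fun z => φ z * f z :=
  (φ.memLp 2).integrable_mul (Lp.memLp f)

/-- A function in `L¹` whose Fourier transform vanishes is zero. -/
theorem ae_eq_zero_of_integral_exp_mul_eq_zero {H : V → ℂ} (hH : Integrable H)
    (h : ∀ y : V, ∫ η, Complex.exp ((2 * Real.pi * inner ℝ η y : ℝ) * Complex.I) * H η = 0) :
    ∀ᵐ η, H η = 0 := by
  refine ae_eq_zero_of_integral_contDiff_smul_eq_zero hH.locallyIntegrable fun g hg hc => ?_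
  -- Writing the test function as a Fourier transform `𝓕 ψ` lets the transform be moved onto `H`,
  -- where it vanishes.
  let χ : 𝓢(V, ℂ) := HasCompactSupport.toSchwartzMap (f := fun z => (g z : ℂ))
    (hc.comp_left (g := fun r : ℝ => (r : ℂ)) Complex.ofReal_zero)
    (Complex.ofRealCLM.contDiff.comp hg)
  let ψ : 𝓢(V, ℂ) := 𝓕⁻ χ
  have h1 : ∫ η, 𝓕 (⇑ψ) η • H η = ∫ x, ψ x • 𝓕 H x := by
    have := VectorFourier.integral_fourierIntegral_smul_eq_flip (L := innerₗ V)
      (μ := volume) (ν := volume) Real.continuous_fourierChar continuous_inner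
      ψ.integrable hH
    rwa [flip_innerₗ] at this
  have h2 : ∀ x, 𝓕 H x = 0 := fun x => by
    rw [Real.fourier_eq', ← h (-x)]
    refine integral_congr_ae (.of_forall fun η => ?_)
    simp [inner_neg_right]
  have h3 : 𝓕 (⇑ψ) = fun z => (g z : ℂ) := by
    rw [← fourier_coe, fourier_fourierInv_eq]
    rfl
  rw [h3] at h1
  simpa [h2] using h1

variable {W : Type*} [NormedAddCommGroup W] [InnerProductSpace ℝ W] [FiniteDimensional ℝ W]
  [MeasurableSpace W] [BorelSpace W]

theorem integral_withLp_prod (F : WithLp 2 (V × W) → ℂ) :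
    ∫ ζ, F ζ = ∫ p : V × W, F (WithLp.toLp 2 p) :=
  ((WithLp.volume_preserving_symm_measurableEquiv_toLp_prod V W).symm.integral_comp' F).symm

theorem integrable_withLp_prod {F : WithLp 2 (V × W) → ℂ} :
    Integrable (fun p : V × W => F (WithLp.toLp 2 p)) ↔ Integrable F :=
  (WithLp.volume_preserving_symm_measurableEquiv_toLp_prod V W).symm.integrable_comp_emb
    (MeasurableEquiv.measurableEmbedding _)

/-- If all the moments `∫ e^{2πi⟨η, y⟩} G` vanish, then `G` is orthogonal to the bounded functions
of `η`. -/
theorem integral_mul_eq_zero_of_integral_exp_snd_mul_eq_zero {G : WithLp 2 (V × W) → ℂ}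
    (hG : Integrable G)
    (h : ∀ y : W, ∫ ζ, Complex.exp ((2 * Real.pi * inner ℝ ζ.snd y : ℝ) * Complex.I) * G ζ = 0)
    {b : W → ℂ} (hb : Measurable b) {B : ℝ} (hB : ∀ η, ‖b η‖ ≤ B) :
    ∫ ζ, b ζ.snd * G ζ = 0 := by
  have hG' : Integrable (fun p : V × W => G (WithLp.toLp 2 p)) := integrable_withLp_prod.2 hG
  have key : ∀ a : W → ℂ, Measurable a → (∃ B : ℝ, ∀ η, ‖a η‖ ≤ B) →
      ∫ ζ : WithLp 2 (V × W), a ζ.snd * G ζ =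
        ∫ η, a η * ∫ τ, G (WithLp.toLp 2 (τ, η)) := by
    rintro a ha ⟨B, hB⟩
    rw [integral_withLp_prod]
    have hi : Integrable (fun p : V × W => a p.2 * G (WithLp.toLp 2 p)) :=
      hG'.bdd_mul (c := B) (ha.comp measurable_snd).aestronglyMeasurable
        (.of_forall fun p => hB p.2)
    refine (integral_prod_symm _ hi).trans ?_
    refine integral_congr_ae (.of_forall fun η => ?_)
    exact integral_const_mul (a η) _
  -- By Fubini the hypothesis says that the integral of `G` over the first variable, as a function
  -- of `η`, has zero Fourier transform; so this marginal vanishes almost everywhere.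
  have hH : ∀ᵐ η, ∫ τ, G (WithLp.toLp 2 (τ, η)) = 0 := by
    refine ae_eq_zero_of_integral_exp_mul_eq_zero hG'.integral_prod_right fun y => ?_
    rw [← h y]
    refine (key _ (Continuous.measurable (by fun_prop)) ⟨1, fun η => ?_⟩).symm
    rw [Complex.norm_exp_ofReal_mul_I]
  refine (key b hb ⟨B, hB⟩).trans (integral_eq_zero_of_ae ?_)
  filter_upwards [hH] with η hη
  simp [hη]

end FourierMultiplier

/-! ### The truncated multiplier inverts the conjugated operator on `0 < t < T` -/

section Parametrix

open FourierTransform SchwartzMap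

variable {n : ℕ}

theorem inner_toLp_coordDir_none (ζ : EuclideanSpaceTime n) :
    inner ℝ ζ (WithLp.toLp 2 (coordDir none)) = ζ.fst := by
  simp [coordDir, WithLp.prod_inner_apply]

theorem inner_toLp_coordDir_some (ζ : EuclideanSpaceTime n) (i : Fin n) :
    inner ℝ ζ (WithLp.toLp 2 (coordDir (some i))) = ζ.snd i := by
  simp [coordDir, WithLp.prod_inner_apply, EuclideanSpace.inner_single_right]

/-- The formal adjoint of `□ - 2 lam (∂_t - ω ⬝ ∇)`. -/
noncomputable def conjugatedWaveAdjoint (ω : Space n) (lam : ℝ)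
    (φ : 𝓢(EuclideanSpaceTime n, ℂ)) : 𝓢(EuclideanSpaceTime n, ℂ) :=
  ∂_{(WithLp.toLp 2 (coordDir none) : EuclideanSpaceTime n)}
      (∂_{(WithLp.toLp 2 (coordDir none) : EuclideanSpaceTime n)} φ) -
    ∑ i : Fin n, ∂_{(WithLp.toLp 2 (coordDir (some i)) : EuclideanSpaceTime n)}
      (∂_{(WithLp.toLp 2 (coordDir (some i)) : EuclideanSpaceTime n)} φ) +
    (2 * lam : ℂ) • (∂_{(WithLp.toLp 2 (coordDir none) : EuclideanSpaceTime n)} φ -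
      ∑ i : Fin n, (ω i : ℂ) • ∂_{(WithLp.toLp 2 (coordDir (some i)) : EuclideanSpaceTime n)} φ)

/-- The inverse transform turns `∂_v` into minus its symbol. This undoes the sign change of the
first-order terms in the adjoint, so the symbol of the operator itself appears. -/
theorem fourierInv_conjugatedWaveAdjoint_apply (ω : Space n) (lam : ℝ)
    (φ : 𝓢(EuclideanSpaceTime n, ℂ)) (ζ : EuclideanSpaceTime n) :
    𝓕⁻ (conjugatedWaveAdjoint ω lam φ) ζ = conjugatedWaveSymbol ω lam ζ * 𝓕⁻ φ ζ := by
  let F : 𝓢(EuclideanSpaceTime n, ℂ) →ₗ[ℂ] ℂ :=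
    { toFun := fun ψ => 𝓕⁻ ψ ζ
      map_add' := fun a b => by rw [FourierTransform.fourierInv_add]; rfl
      map_smul' := fun a b => by rw [FourierTransform.fourierInv_smul]; rfl }
  have hF : ∀ ψ (v : EuclideanSpaceTime n), F (∂_{v} ψ) =
      -((2 * Real.pi * inner ℝ ζ v : ℝ) * Complex.I * F ψ) :=
    fun ψ v => fourierInv_lineDerivOp_apply ψ v ζ
  change F (conjugatedWaveAdjoint ω lam φ) = conjugatedWaveSymbol ω lam ζ * F φ
  have h1 : ((‖ζ.snd‖ : ℂ)) ^ 2 = ∑ i, (ζ.snd i : ℂ) ^ 2 := by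
    rw [← Complex.ofReal_pow, EuclideanSpace.real_norm_sq_eq]
    push_cast
    rfl
  have h2 : ((inner ℝ ζ.snd ω : ℝ) : ℂ) = ∑ i, (ω i : ℂ) * (ζ.snd i : ℂ) := by
    simp [PiLp.inner_apply]
  simp only [conjugatedWaveAdjoint, map_add, map_sub, map_smul, map_sum, hF,
    inner_toLp_coordDir_none, inner_toLp_coordDir_some, conjugatedWaveSymbol, spatialSymbol,
    timeSymbol, smul_eq_mul]
  push_cast
  rw [mul_pow _ (‖ζ.snd‖ : ℂ), h1, h2]
  have h3 : ∑ i, -((2 : ℂ) * Real.pi * (ζ.snd i : ℂ) * Complex.I *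
      -(2 * Real.pi * (ζ.snd i : ℂ) * Complex.I * F φ)) =
      -((2 * Real.pi) ^ 2 * ∑ i, (ζ.snd i : ℂ) ^ 2) * F φ := by
    rw [Finset.mul_sum, ← Finset.sum_neg_distrib, Finset.sum_mul]
    refine Finset.sum_congr rfl fun i _ => ?_
    linear_combination ((2 * Real.pi) ^ 2 * (ζ.snd i : ℂ) ^ 2 * F φ) * Complex.I_sq
  have h4 : ∑ i, (ω i : ℂ) * -((2 : ℂ) * Real.pi * (ζ.snd i : ℂ) * Complex.I * F φ) =
      -(2 * Real.pi * Complex.I * F φ * ∑ i, (ω i : ℂ) * (ζ.snd i : ℂ)) := by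
    rw [Finset.mul_sum, ← Finset.sum_neg_distrib]
    refine Finset.sum_congr rfl fun i _ => ?_
    ring
  rw [h3, h4]
  ring

theorem lineDerivOp_eq_zero_of_eqOn {ψ : 𝓢(EuclideanSpaceTime n, ℂ)} {T : ℝ}
    (hψ : ∀ z, z.fst < T → ψ z = 0) (v : EuclideanSpaceTime n) (z : EuclideanSpaceTime n)
    (hz : z.fst < T) : ∂_{v} ψ z = 0 := by
  have hc : Continuous fun z : EuclideanSpaceTime n => z.fst := by fun_prop
  have h : ψ =ᶠ[𝓝 z] fun _ => (0 : ℂ) := by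
    filter_upwards [hc.continuousAt.eventually_lt continuousAt_const hz] with y hy using hψ y hy
  rw [SchwartzMap.lineDerivOp_apply_eq_fderiv, h.fderiv_eq]
  simp

/-- The multipliers which only depend on the space frequency do not change the support in time. -/
theorem integral_fourierInv_mul_snd_mul_fourier_eq_zero {T : ℝ}
    {ψ : 𝓢(EuclideanSpaceTime n, ℂ)} (hψ : ∀ z, z.fst < T → ψ z = 0)
    {f : Lp ℂ 2 (volume : Measure (EuclideanSpaceTime n))} (hf : ∀ᵐ z, ¬z.fst < T → f z = 0)
    {b : Space n → ℂ} (hb : Measurable b) {B : ℝ} (hB : ∀ η, ‖b η‖ ≤ B) :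
    ∫ ζ : EuclideanSpaceTime n, b ζ.snd *
      (𝓕⁻ ψ ζ * (𝓕 f : Lp ℂ 2 (volume : Measure (EuclideanSpaceTime n))) ζ) = 0 := by
  refine integral_mul_eq_zero_of_integral_exp_snd_mul_eq_zero
    (integrable_schwartz_mul_lp (𝓕⁻ ψ) (𝓕 f)) (fun y => ?_) hb hB
  -- An exponential in the space frequency is a translation by `(0, y)`, which preserves the support
  -- in time; `ψ` and `f` therefore stay disjoint.
  have e : ∀ ζ : EuclideanSpaceTime n,
      Complex.exp ((2 * Real.pi * inner ℝ ζ.snd y : ℝ) * Complex.I) *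
        (𝓕⁻ ψ ζ * (𝓕 f : Lp ℂ 2 (volume : Measure (EuclideanSpaceTime n))) ζ) =
      𝓕⁻ (compSubConstCLM ℂ (WithLp.toLp 2 (0, y) : EuclideanSpaceTime n) ψ) ζ *
        (𝓕 f : Lp ℂ 2 (volume : Measure (EuclideanSpaceTime n))) ζ := by
    intro ζ
    rw [fourierInv_compSubConst_apply]
    simp [WithLp.prod_inner_apply, mul_assoc]
  simp_rw [e]
  rw [← integral_mul_eq_integral_fourierInv_mul_fourier]
  refine integral_eq_zero_of_ae ?_
  filter_upwards [hf] with z hz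
  by_cases h : z.fst < T
  · simp [hψ (z - WithLp.toLp 2 (0, y)) (by simpa using h)]
  · simp [hz h]

variable {ω : Space n} {lam T : ℝ}

theorem norm_dampedSine_spatialSymbol_le (hω : ‖ω‖ = 1) (hlam : 1 ≤ lam) (hT : 0 ≤ T)
    (η : Space n) : lam * ‖dampedSine lam (spatialSymbol ω lam η) T‖ ≤ 1 := by
  have hlam0 : 0 ≤ lam := by linarith
  have h := norm_dampedSine_le hlam0 (spatialSymbol_bound hω hlam0 η) hT
  refine le_trans ?_ h
  exact mul_le_mul_of_nonneg_right
    (Real.le_sqrt_of_sq_le (by nlinarith [sq_nonneg (2 * Real.pi * ‖η‖)])) (norm_nonneg _)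

theorem norm_dampedCosine_spatialSymbol_le (hω : ‖ω‖ = 1) (hlam : 1 ≤ lam) (hT : 0 ≤ T)
    (η : Space n) : ‖dampedCosine lam (spatialSymbol ω lam η) T‖ ≤ 1 :=
  norm_dampedCosine_le (by linarith) (spatialSymbol_bound hω (by linarith) η) hT

/-- The symbol identity reproduces `f` up to two truncation terms. The factor `exp (s T)` delays the
test function by `T`, past the support of `f`, and the remaining coefficients depend on `η` only, so
both terms vanish. -/
theorem integral_conjugatedWaveAdjoint_mul_lpMultiplier (hω : ‖ω‖ = 1) (hlam : 1 ≤ lam)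
    (hT : 0 ≤ T) {σ : Lp ℂ ∞ (volume : Measure (EuclideanSpaceTime n))}
    (hσ : σ =ᵐ[volume] waveMultiplier T ω lam)
    {φ : 𝓢(EuclideanSpaceTime n, ℂ)} (hφ : ∀ z, z.fst < 0 → φ z = 0)
    {f : Lp ℂ 2 (volume : Measure (EuclideanSpaceTime n))} (hf : ∀ᵐ z, ¬z.fst < T → f z = 0) :
    ∫ z, conjugatedWaveAdjoint ω lam φ z * lpMultiplier σ f z = ∫ z, φ z * f z := by
  have hlam0 : 0 ≤ lam := by linarith
  let φT : 𝓢(EuclideanSpaceTime n, ℂ) :=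
    compSubConstCLM ℂ (WithLp.toLp 2 (T, 0) : EuclideanSpaceTime n) φ
  let dφT : 𝓢(EuclideanSpaceTime n, ℂ) :=
    ∂_{(WithLp.toLp 2 (coordDir none) : EuclideanSpaceTime n)} φT
  have hφT : ∀ z, z.fst < T → φT z = 0 := fun z hz =>
    hφ (z - WithLp.toLp 2 (T, 0)) (by simpa using hz)
  let a : Space n → ℂ := fun η => dampedSine lam (spatialSymbol ω lam η) T
  let b : Space n → ℂ := fun η => dampedCosine lam (spatialSymbol ω lam η) T +
    lam * dampedSine lam (spatialSymbol ω lam η) T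
  have ham : Measurable a :=
    (measurable_dampedSine lam).comp ((measurable_spatialSymbol ω lam).prodMk measurable_const)
  have hbm : Measurable b :=
    ((measurable_dampedCosine lam).comp
      ((measurable_spatialSymbol ω lam).prodMk measurable_const)).add (ham.const_mul (lam : ℂ))
  have haB : ∀ η, ‖a η‖ ≤ 1 := fun η =>
    (le_mul_of_one_le_left (norm_nonneg _) hlam).trans
      (norm_dampedSine_spatialSymbol_le hω hlam hT η)
  have hbB : ∀ η, ‖b η‖ ≤ 1 + 1 := fun η => by
    refine (norm_add_le _ _).trans (add_le_add
      (norm_dampedCosine_spatialSymbol_le hω hlam hT η) ?_)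
    rw [norm_mul, Complex.norm_real, Real.norm_of_nonneg hlam0]
    exact norm_dampedSine_spatialSymbol_le hω hlam hT η
  -- The truncation term with the factor `s` is read as a time derivative of the delayed test
  -- function, so that `a` and `b` are bounded functions of `η` alone.
  have e : ∀ᵐ ζ : EuclideanSpaceTime n, 𝓕⁻ (conjugatedWaveAdjoint ω lam φ) ζ *
      (σ ζ * (𝓕 f : Lp ℂ 2 (volume : Measure (EuclideanSpaceTime n))) ζ) =
      𝓕⁻ φ ζ * (𝓕 f : Lp ℂ 2 (volume : Measure (EuclideanSpaceTime n))) ζ -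
      a ζ.snd * (𝓕⁻ dφT ζ * (𝓕 f : Lp ℂ 2 (volume : Measure (EuclideanSpaceTime n))) ζ) -
      b ζ.snd * (𝓕⁻ φT ζ * (𝓕 f : Lp ℂ 2 (volume : Measure (EuclideanSpaceTime n))) ζ) := by
    filter_upwards [hσ] with ζ hζ
    have h1 := truncatedLaplace_symbol_mul T lam (spatialSymbol ω lam ζ.snd) (timeSymbol ζ)
    have h2 : 𝓕⁻ dφT ζ = -(timeSymbol ζ * 𝓕⁻ φT ζ) := by
      rw [fourierInv_lineDerivOp_apply, inner_toLp_coordDir_none, timeSymbol]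
    have h3 : 𝓕⁻ φT ζ = Complex.exp (timeSymbol ζ * T) * 𝓕⁻ φ ζ := by
      rw [fourierInv_compSubConst_apply, timeSymbol]
      congr 2
      simp [WithLp.prod_inner_apply]
      ring
    rw [fourierInv_conjugatedWaveAdjoint_apply, hζ, h2, h3, conjugatedWaveSymbol, waveMultiplier]
    linear_combination (𝓕⁻ φ ζ *
      (𝓕 f : Lp ℂ 2 (volume : Measure (EuclideanSpaceTime n))) ζ) * h1
  have hi : ∀ (ψ : 𝓢(EuclideanSpaceTime n, ℂ)) (a : Space n → ℂ), Measurable a →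
      (∃ B : ℝ, ∀ η, ‖a η‖ ≤ B) → Integrable fun ζ : EuclideanSpaceTime n => a ζ.snd *
        (𝓕⁻ ψ ζ * (𝓕 f : Lp ℂ 2 (volume : Measure (EuclideanSpaceTime n))) ζ) := by
    rintro ψ a ha ⟨B, hB⟩
    have hs : Measurable fun ζ : EuclideanSpaceTime n => ζ.snd := by fun_prop
    exact (integrable_schwartz_mul_lp (𝓕⁻ ψ) (𝓕 f)).bdd_mul (c := B)
      (ha.comp hs).aestronglyMeasurable (.of_forall fun ζ => hB _)
  have h0 := integrable_schwartz_mul_lp (𝓕⁻ φ) (𝓕 f)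
  have ha := hi dφT a ham ⟨_, haB⟩
  have hb := hi φT b hbm ⟨_, hbB⟩
  rw [integral_mul_lpMultiplier, integral_congr_ae e]
  refine (integral_sub (h0.sub ha) hb).trans ?_
  refine (congrArg₂ (· - ·) (integral_sub h0 ha) rfl).trans ?_
  rw [integral_fourierInv_mul_snd_mul_fourier_eq_zero
      (lineDerivOp_eq_zero_of_eqOn hφT _) hf ham haB,
    integral_fourierInv_mul_snd_mul_fourier_eq_zero hφT hf hbm hbB, sub_zero, sub_zero]
  exact (integral_mul_eq_integral_fourierInv_mul_fourier φ f).symm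

end Parametrix

/-! ### Test functions on `Q` and their transfer to Euclidean space-time -/

section TestFunctions

variable {n : ℕ} {Q : TopologicalSpace.Opens (SpaceTime n)}

theorem TestFunction.lineDerivOp_apply_eq_fderiv (φ : 𝓓(Q, ℂ)) (v z : SpaceTime n) :
    (∂_{v} φ) z = fderiv ℝ φ z v := by
  rw [TestFunction.lineDerivOp_eq_lineDerivCLM ℝ,
    TestFunction.lineDerivCLM_apply_of_le (by simp)]
  exact (φ.contDiff.differentiable (by simp)).differentiableAt.lineDeriv_eq_fderiv

theorem TestFunction.eq_zero_of_notMem (φ : 𝓓(Q, ℂ)) {z : SpaceTime n} (hz : z ∉ Q) : φ z = 0 :=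
  image_eq_zero_of_notMem_tsupport fun h => hz (φ.tsupport_subset h)

/-- The product of a test function with a smooth function. -/
noncomputable def TestFunction.smoothMul (a : SpaceTime n → ℂ) (ha : ContDiff ℝ (⊤ : ℕ∞) a)
    (φ : 𝓓(Q, ℂ)) : 𝓓(Q, ℂ) :=
  ⟨fun z => a z * φ z, ha.mul φ.contDiff, φ.hasCompactSupport.mul_left,
    (tsupport_mul_subset_right (f := a) (g := φ)).trans φ.tsupport_subset⟩

@[simp]
theorem TestFunction.smoothMul_apply (a : SpaceTime n → ℂ) (ha : ContDiff ℝ (⊤ : ℕ∞) a)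
    (φ : 𝓓(Q, ℂ)) (z : SpaceTime n) : φ.smoothMul a ha z = a z * φ z := rfl

theorem TestFunction.lineDerivOp_smoothMul_apply (a : SpaceTime n → ℂ)
    (ha : ContDiff ℝ (⊤ : ℕ∞) a) (φ : 𝓓(Q, ℂ)) (v z : SpaceTime n) :
    (∂_{v} (φ.smoothMul a ha)) z = a z * (∂_{v} φ) z + fderiv ℝ a z v * φ z := by
  rw [TestFunction.lineDerivOp_apply_eq_fderiv, TestFunction.lineDerivOp_apply_eq_fderiv]
  have h := ((ha.differentiable (by simp)) z).hasFDerivAt.mul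
    ((φ.contDiff.differentiable (by simp)) z).hasFDerivAt
  have e : (φ.smoothMul a ha : SpaceTime n → ℂ) = a * φ := rfl
  rw [e, h.fderiv]
  simp [mul_comm (φ z)]

theorem MeasureTheory.LocallyIntegrableOn.integrable_mul_testFunction {f : SpaceTime n → ℂ}
    (hf : LocallyIntegrableOn f Q) (φ : 𝓓(Q, ℂ)) : Integrable fun z => f z * φ z := by
  simpa [mul_comm] using φ.integrable_bilin (ContinuousLinearMap.mul ℂ ℂ) hf

theorem setIntegral_mul_testFunction (f : SpaceTime n → ℂ) (φ : 𝓓(Q, ℂ)) :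
    ∫ z in Q, f z * φ z = ∫ z, f z * φ z :=
  setIntegral_eq_integral_of_forall_compl_eq_zero fun z hz => by
    rw [φ.eq_zero_of_notMem hz, mul_zero]

open SchwartzMap in
/-- A test function as a Schwartz function on Euclidean space-time. -/
noncomputable def TestFunction.toEuclideanSchwartz (φ : 𝓓(Q, ℂ)) :
    𝓢(EuclideanSpaceTime n, ℂ) :=
  compCLMOfContinuousLinearEquiv ℂ (WithLp.prodContinuousLinearEquiv 2 ℝ ℝ (Space n))
    (HasCompactSupport.toSchwartzMap φ.hasCompactSupport φ.contDiff)

theorem TestFunction.toEuclideanSchwartz_apply (φ : 𝓓(Q, ℂ)) (z : EuclideanSpaceTime n) :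
    φ.toEuclideanSchwartz z = φ (WithLp.ofLp z) := rfl

theorem TestFunction.lineDerivOp_toEuclideanSchwartz (φ : 𝓓(Q, ℂ)) (v : SpaceTime n) :
    ∂_{(WithLp.toLp 2 v : EuclideanSpaceTime n)} φ.toEuclideanSchwartz =
      (∂_{v} φ).toEuclideanSchwartz := by
  rw [TestFunction.toEuclideanSchwartz, SchwartzMap.lineDerivOp_compCLMOfContinuousLinearEquiv]
  ext z
  rw [TestFunction.toEuclideanSchwartz_apply, TestFunction.lineDerivOp_apply_eq_fderiv,
    SchwartzMap.compCLMOfContinuousLinearEquiv_apply, Function.comp_apply,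
    SchwartzMap.lineDerivOp_apply_eq_fderiv]
  rfl

theorem integral_toEuclideanSchwartz_mul (φ : 𝓓(Q, ℂ)) (f : EuclideanSpaceTime n → ℂ) :
    ∫ z, φ.toEuclideanSchwartz z * f z = ∫ z in Q, f (WithLp.toLp 2 z) * φ z := by
  rw [setIntegral_mul_testFunction, integral_withLp_prod]
  refine integral_congr_ae (.of_forall fun z => ?_)
  exact mul_comm _ _

end TestFunctions

/-! ### Calculus of weak derivatives and of `H¹` -/

section WeakDerivatives

variable {n : ℕ} {Q : TopologicalSpace.Opens (SpaceTime n)} {v : SpaceTime n}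
  {f f₁ f₂ g g₁ g₂ a : SpaceTime n → ℂ}

theorem HasWeakDeriv.add (h₁ : HasWeakDeriv Q v f₁ g₁) (h₂ : HasWeakDeriv Q v f₂ g₂) :
    HasWeakDeriv Q v (fun z => f₁ z + f₂ z) (fun z => g₁ z + g₂ z) := by
  refine ⟨h₁.1.add h₂.1, h₁.2.1.add h₂.2.1, fun φ => ?_⟩
  simp only [add_mul]
  rw [integral_add (h₁.1.integrable_mul_testFunction _).integrableOn
      (h₂.1.integrable_mul_testFunction _).integrableOn,
    integral_add (h₁.2.1.integrable_mul_testFunction _).integrableOn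
      (h₂.2.1.integrable_mul_testFunction _).integrableOn, h₁.2.2, h₂.2.2, neg_add]

/-- The factor `a` is absorbed into the test function, and the Leibniz rule there produces the extra
term. -/
theorem HasWeakDeriv.smooth_mul (h : HasWeakDeriv Q v f g) (ha : ContDiff ℝ (⊤ : ℕ∞) a) :
    HasWeakDeriv Q v (fun z => a z * f z) (fun z => a z * g z + fderiv ℝ a z v * f z) := by
  have hda : Continuous fun z => fderiv ℝ a z v :=
    (ha.continuous_fderiv (by simp)).clm_apply continuous_const
  have hmul : ∀ {b k : SpaceTime n → ℂ}, Continuous b → LocallyIntegrableOn k Q →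
      LocallyIntegrableOn (fun z => b z * k z) Q := fun hb hk =>
    hk.continuousOn_mul hb.continuousOn Q.isOpen.isLocallyClosed
  have h1 := hmul ha.continuous h.2.1
  have h2 := hmul hda h.1
  refine ⟨hmul ha.continuous h.1, h1.add h2, fun φ => ?_⟩
  have e1 : ∀ z, a z * f z * (∂_{v} φ) z =
      f z * (∂_{v} (φ.smoothMul a ha)) z - fderiv ℝ a z v * f z * φ z := fun z => by
    rw [TestFunction.lineDerivOp_smoothMul_apply]; ring
  have e2 : ∀ z, (a z * g z + fderiv ℝ a z v * f z) * φ z =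
      g z * φ.smoothMul a ha z + fderiv ℝ a z v * f z * φ z := fun z => by
    rw [TestFunction.smoothMul_apply]; ring
  simp_rw [e1, e2]
  rw [integral_sub (h.1.integrable_mul_testFunction _).integrableOn
      (h2.integrable_mul_testFunction _).integrableOn,
    integral_add (h.2.1.integrable_mul_testFunction _).integrableOn
      (h2.integrable_mul_testFunction _).integrableOn, h.2.2]
  ring

/-- Together with the product rule this gives the weak derivatives of all the exponentials used. -/
theorem hasWeakDeriv_one : HasWeakDeriv Q v (fun _ => 1) (fun _ => 0) := by
  refine ⟨(locallyIntegrable_const 1).locallyIntegrableOn _,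
    (locallyIntegrable_const 0).locallyIntegrableOn _, fun φ => ?_⟩
  rw [setIntegral_mul_testFunction, setIntegral_mul_testFunction]
  have : (volume : Measure (SpaceTime n)).IsAddHaarMeasure :=
    Measure.prod.instIsAddHaarMeasure _ _
  have h := integral_mul_fderiv_eq_neg_fderiv_mul_of_integrable (μ := volume) (v := v)
    (f := fun _ : SpaceTime n => (1 : ℂ)) (g := φ) (by simp) ?_ ?_
    (fun z _ => differentiableAt_const _)
    (fun z _ => (φ.contDiff.differentiable (by simp)) z)
  · simpa [TestFunction.lineDerivOp_apply_eq_fderiv] using h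
  · simpa [TestFunction.lineDerivOp_apply_eq_fderiv] using
      ((locallyIntegrable_const (1 : ℂ)).locallyIntegrableOn _).integrable_mul_testFunction
        (∂_{v} φ)
  · exact ((locallyIntegrable_const (1 : ℂ)).locallyIntegrableOn _).integrable_mul_testFunction φ

theorem HasWeakDeriv.congr (h : HasWeakDeriv Q v f₁ g₁) (hf : f₁ = f₂) (hg : g₁ = g₂) :
    HasWeakDeriv Q v f₂ g₂ := hf ▸ hg ▸ h

theorem MemH1.add (h₁ : MemH1 Q f₁) (h₂ : MemH1 Q f₂) : MemH1 Q (fun z => f₁ z + f₂ z) := by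
  refine ⟨h₁.1.add h₂.1, fun j => ?_⟩
  obtain ⟨g₁, hg₁, hw₁⟩ := h₁.2 j
  obtain ⟨g₂, hg₂, hw₂⟩ := h₂.2 j
  exact ⟨_, hg₁.add hg₂, hw₁.add hw₂⟩

theorem MeasureTheory.MemLp.continuous_mul_of_isBounded {p : ℝ≥0∞}
    (hQ : Bornology.IsBounded (Q : Set (SpaceTime n))) (ha : Continuous a)
    (hf : MemLp f p (volume.restrict Q)) :
    MemLp (fun z => a z * f z) p (volume.restrict Q) := by
  obtain ⟨C, hC⟩ := hQ.isCompact_closure.exists_bound_of_continuousOn ha.continuousOn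
  refine hf.of_le_mul (c := C) (ha.aestronglyMeasurable.mul hf.1) ?_
  refine (ae_restrict_iff' Q.isOpen.measurableSet).2 (.of_forall fun z hz => ?_)
  rw [norm_mul]
  gcongr
  exact hC z (subset_closure hz)

theorem MemH1.smooth_mul (hQ : Bornology.IsBounded (Q : Set (SpaceTime n)))
    (ha : ContDiff ℝ (⊤ : ℕ∞) a) (h : MemH1 Q f) : MemH1 Q (fun z => a z * f z) := by
  refine ⟨h.1.continuous_mul_of_isBounded hQ ha.continuous, fun j => ?_⟩
  obtain ⟨g, hg, hw⟩ := h.2 j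
  have hda : Continuous fun z => fderiv ℝ a z (coordDir j) :=
    (ha.continuous_fderiv (by simp)).clm_apply continuous_const
  exact ⟨_, (hg.continuous_mul_of_isBounded hQ ha.continuous).add
    (h.1.continuous_mul_of_isBounded hQ hda), hw.smooth_mul ha⟩

theorem memH1_one (hQ : Bornology.IsBounded (Q : Set (SpaceTime n))) :
    MemH1 Q (fun _ => 1) := by
  have : IsFiniteMeasure (volume.restrict (Q : Set (SpaceTime n))) :=
    ⟨by simpa using hQ.measure_lt_top⟩
  exact ⟨memLp_const 1, fun j => ⟨_, MemLp.zero', hasWeakDeriv_one⟩⟩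

theorem normH1_le {D : ℝ≥0∞} (h0 : normL2 Q f ≤ D)
    (h : ∀ j, normL2WeakDeriv Q (coordDir j) f ≤ D) : normH1 Q f ≤ (n + 2) * D := by
  have h1 : normL2 Q f ^ 2 + ∑ j : Option (Fin n), normL2WeakDeriv Q (coordDir j) f ^ 2 ≤
      ((n + 2) * D) ^ (2 : ℝ) := by
    calc normL2 Q f ^ 2 + ∑ j : Option (Fin n), normL2WeakDeriv Q (coordDir j) f ^ 2
        ≤ D ^ 2 + ∑ _j : Option (Fin n), D ^ 2 := by
          gcongr with j
          exact h j
      _ = (n + 2) * D ^ 2 := by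
          simp only [Finset.sum_const, Finset.card_univ, Fintype.card_option, Fintype.card_fin,
            nsmul_eq_mul]
          push_cast
          ring
      _ ≤ (n + 2) ^ 2 * D ^ 2 := by
          gcongr
          exact le_self_pow (le_add_left (by norm_num)) two_ne_zero
      _ = ((n + 2) * D) ^ (2 : ℝ) := by rw [← mul_pow]; norm_cast
  rw [normH1]
  refine (ENNReal.rpow_le_rpow h1 (by norm_num)).trans_eq ?_
  rw [← ENNReal.rpow_mul]
  norm_num

end WeakDerivatives

/-! ### Extension by zero, restriction to `Q`, and the contraction -/

section LpLemmas

variable {n : ℕ} {Q : TopologicalSpace.Opens (SpaceTime n)}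

theorem exists_lp_top_ae_eq {α : Type*} [MeasurableSpace α] {μ : Measure α} {m : α → ℂ}
    (hm : AEStronglyMeasurable m μ) {B : ℝ} (hB0 : 0 ≤ B) (hB : ∀ z, ‖m z‖ ≤ B) :
    ∃ σ : Lp ℂ ∞ μ, σ =ᵐ[μ] m ∧ ‖σ‖ ≤ B := by
  have h := memLp_top_of_bound hm B (.of_forall hB)
  refine ⟨h.toLp m, h.coeFn_toLp, ?_⟩
  rw [Lp.norm_toLp]
  refine ENNReal.toReal_le_of_le_ofReal hB0 ?_
  rw [eLpNorm_exponent_top]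
  exact eLpNormEssSup_le_of_ae_bound (.of_forall hB)

/-- Extension by zero from `Q` to Euclidean space-time. -/
theorem exists_lp_ae_eq_indicator {p : ℝ≥0∞} [Fact (1 ≤ p)] {h : SpaceTime n → ℂ}
    (hh : MemLp h p (volume.restrict Q)) :
    ∃ H : Lp ℂ p (volume : Measure (EuclideanSpaceTime n)),
      (∀ᵐ z, H z = (Q : Set (SpaceTime n)).indicator h (WithLp.ofLp z)) ∧
      ‖H‖ = (eLpNorm h p (volume.restrict Q)).toReal := by
  have hi := (memLp_indicator_iff_restrict Q.isOpen.measurableSet).2 hh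
  have hpres := WithLp.volume_preserving_ofLp ℝ (Space n)
  have hc := hi.comp_measurePreserving hpres
  refine ⟨hc.toLp _, hc.coeFn_toLp, ?_⟩
  rw [Lp.norm_toLp, eLpNorm_comp_measurePreserving hi.1 hpres,
    eLpNorm_indicator_eq_eLpNorm_restrict Q.isOpen.measurableSet]

theorem memLp_restrict_comp_toLp (W : Lp ℂ 2 (volume : Measure (EuclideanSpaceTime n))) :
    MemLp (fun z => W (WithLp.toLp 2 z)) 2 (volume.restrict (Q : Set (SpaceTime n))) :=
  ((Lp.memLp W).comp_measurePreserving (WithLp.volume_preserving_toLp ℝ (Space n))).restrict _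

theorem normL2_comp_toLp_le (W : Lp ℂ 2 (volume : Measure (EuclideanSpaceTime n))) :
    normL2 Q (fun z => W (WithLp.toLp 2 z)) ≤ ENNReal.ofReal ‖W‖ := by
  refine (eLpNorm_restrict_le _ _ _ _).trans ?_
  rw [Lp.norm_def, ENNReal.ofReal_toReal (Lp.eLpNorm_ne_top W)]
  exact (eLpNorm_comp_measurePreserving (Lp.aestronglyMeasurable W)
    (WithLp.volume_preserving_toLp ℝ (Space n))).le

theorem MeasureTheory.MemLp.locallyIntegrableOn_opens {h : SpaceTime n → ℂ}
    (hh : MemLp h 2 (volume.restrict Q)) : LocallyIntegrableOn h Q :=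
  locallyIntegrableOn_of_locallyIntegrable_restrict (hh.locallyIntegrable (by norm_num))

theorem hasWeakDeriv_lpMultiplier
    {σ σ' : Lp ℂ ∞ (volume : Measure (EuclideanSpaceTime n))} {v : SpaceTime n}
    (h : ∀ᵐ ζ, σ' ζ = (2 * Real.pi * inner ℝ ζ (WithLp.toLp 2 v) : ℝ) * Complex.I * σ ζ)
    (f : Lp ℂ 2 (volume : Measure (EuclideanSpaceTime n))) :
    HasWeakDeriv Q v (fun z => lpMultiplier σ f (WithLp.toLp 2 z))
      (fun z => lpMultiplier σ' f (WithLp.toLp 2 z)) := by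
  refine ⟨(memLp_restrict_comp_toLp _).locallyIntegrableOn_opens,
    (memLp_restrict_comp_toLp _).locallyIntegrableOn_opens, fun φ => ?_⟩
  rw [← integral_toEuclideanSchwartz_mul, ← integral_toEuclideanSchwartz_mul,
    ← TestFunction.lineDerivOp_toEuclideanSchwartz, integral_lineDeriv_mul_lpMultiplier h]

/-- Banach's fixed point theorem with ratio `1/2`; the factor `2` is the sum of the geometric
series. -/
theorem exists_fixedPoint_lpMultiplier
    {V : Type*} [NormedAddCommGroup V] [InnerProductSpace ℝ V] [FiniteDimensional ℝ V]
    [MeasurableSpace V] [BorelSpace V] {σ q : Lp ℂ ∞ (volume : Measure V)}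
    (h : ‖q‖ * ‖σ‖ ≤ 1 / 2) (F : Lp ℂ 2 (volume : Measure V)) :
    ∃ f : Lp ℂ 2 (volume : Measure V),
      f = F - (q • lpMultiplier σ f : Lp ℂ 2 (volume : Measure V)) ∧ ‖f‖ ≤ 2 * ‖F‖ := by
  have hb : ∀ g, ‖(q • lpMultiplier σ g : Lp ℂ 2 (volume : Measure V))‖ ≤ 1 / 2 * ‖g‖ := fun g =>
    calc ‖(q • lpMultiplier σ g : Lp ℂ 2 (volume : Measure V))‖
        ≤ ‖q‖ * (‖σ‖ * ‖g‖) := (Lp.norm_smul_le _ _).trans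
          (mul_le_mul_of_nonneg_left (norm_lpMultiplier_le σ g) (norm_nonneg _))
      _ ≤ 1 / 2 * ‖g‖ := by
          rw [← mul_assoc]
          exact mul_le_mul_of_nonneg_right h (norm_nonneg _)
  have hc : ContractingWith (1 / 2) fun g : Lp ℂ 2 (volume : Measure V) =>
      F - (q • lpMultiplier σ g : Lp ℂ 2 (volume : Measure V)) := by
    refine ⟨by norm_num, LipschitzWith.of_dist_le_mul fun a b => ?_⟩
    rw [dist_sub_left, dist_eq_norm, dist_eq_norm, sub_eq_add_neg, ← Lp.smul_neg, ← Lp.add_smul,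
      ← sub_eq_add_neg, ← lpMultiplier_sub]
    simpa using hb (a - b)
  refine ⟨_, hc.fixedPoint_isFixedPt.symm, ?_⟩
  set f := hc.fixedPoint
  have e : f = F - (q • lpMultiplier σ f : Lp ℂ 2 (volume : Measure V)) :=
    hc.fixedPoint_isFixedPt.symm
  have h1 : ‖f‖ ≤ ‖F‖ + 1 / 2 * ‖f‖ := by
    conv_lhs => rw [e]
    exact (norm_sub_le _ _).trans (add_le_add_right (hb f) _)
  linarith

theorem exists_waveMultiplier_lp {ω : Space n} {lam T : ℝ} (hω : ‖ω‖ = 1) (hlam : 1 ≤ lam)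
    (hT : 0 ≤ T) : ∃ σ : Lp ℂ ∞ (volume : Measure (EuclideanSpaceTime n)),
      σ =ᵐ[volume] waveMultiplier T ω lam ∧ ‖σ‖ ≤ T * lam⁻¹ ∧
      ∀ j : Option (Fin n), ∃ σ' : Lp ℂ ∞ (volume : Measure (EuclideanSpaceTime n)),
        (∀ᵐ ζ, σ' ζ = (2 * Real.pi * inner ℝ ζ (WithLp.toLp 2 (coordDir j)) : ℝ) *
          Complex.I * σ ζ) ∧ ‖σ'‖ ≤ 1 + 2 * T := by
  have hlam0 : 0 < lam := by linarith
  have hm := measurable_waveMultiplier T ω lam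
  obtain ⟨σ, hσ, hσB⟩ := exists_lp_top_ae_eq (μ := volume) hm.aestronglyMeasurable
    (by positivity) (norm_waveMultiplier_le hω hlam0 hT)
  refine ⟨σ, hσ, hσB, fun j => ?_⟩
  have hc : Continuous fun ζ : EuclideanSpaceTime n =>
      ((2 * Real.pi * inner ℝ ζ (WithLp.toLp 2 (coordDir j)) : ℝ) * Complex.I : ℂ) := by fun_prop
  have hb : ∀ ζ : EuclideanSpaceTime n,
      ‖((2 * Real.pi * inner ℝ ζ (WithLp.toLp 2 (coordDir j)) : ℝ) * Complex.I : ℂ) *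
        waveMultiplier T ω lam ζ‖ ≤ 1 + 2 * T := by
    intro ζ
    cases j with
    | none =>
      rw [inner_toLp_coordDir_none]
      exact norm_time_mul_waveMultiplier_le hω hlam hT ζ
    | some i =>
      rw [inner_toLp_coordDir_some, norm_mul, norm_mul, Complex.norm_I, mul_one, Complex.norm_real,
        norm_mul, Real.norm_of_nonneg (by positivity)]
      have h1 : ‖ζ.snd i‖ ≤ ‖ζ.snd‖ := PiLp.norm_apply_le _ i
      calc 2 * Real.pi * ‖ζ.snd i‖ * ‖waveMultiplier T ω lam ζ‖
          ≤ 2 * Real.pi * ‖ζ.snd‖ * ‖waveMultiplier T ω lam ζ‖ := by gcongr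
        _ ≤ T := norm_space_mul_waveMultiplier_le hω hlam0 hT ζ
        _ ≤ 1 + 2 * T := by linarith
  obtain ⟨σ', hσ', hσB'⟩ := exists_lp_top_ae_eq (μ := volume)
    (hc.measurable.mul hm).aestronglyMeasurable (by positivity) hb
  refine ⟨σ', ?_, hσB'⟩
  filter_upwards [hσ, hσ'] with ζ h1 h2
  rw [h2, Pi.mul_apply, h1]

end LpLemmas

/-! ### Conjugation of the wave operator, and its action on plane waves -/

section ConjugatedWaveOperator

variable {n : ℕ} {Q : TopologicalSpace.Opens (SpaceTime n)}

/-- The formal adjoint of `□ - 2 lam (∂_t - ω ⬝ ∇)` on test functions. -/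
noncomputable def conjugatedWaveOp (Q : TopologicalSpace.Opens (SpaceTime n)) (ω : Space n)
    (lam : ℝ) (ψ : 𝓓(Q, ℂ)) : 𝓓(Q, ℂ) :=
  waveOp Q ψ + (2 * lam : ℂ) • (∂_{(coordDir none : SpaceTime n)} ψ -
    ∑ i : Fin n, (ω i : ℂ) • ∂_{(coordDir (some i) : SpaceTime n)} ψ)

/-- Evaluation of test functions at a point. -/
noncomputable def testEval (z : SpaceTime n) : 𝓓(Q, ℂ) →ₗ[ℂ] ℂ where
  toFun φ := φ z
  map_add' _ _ := rfl
  map_smul' _ _ := rfl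

theorem toEuclideanSchwartz_conjugatedWaveOp (ω : Space n) (lam : ℝ) (ψ : 𝓓(Q, ℂ)) :
    (conjugatedWaveOp Q ω lam ψ).toEuclideanSchwartz =
      conjugatedWaveAdjoint ω lam ψ.toEuclideanSchwartz := by
  let F : 𝓓(Q, ℂ) →ₗ[ℂ] SchwartzMap (EuclideanSpaceTime n) ℂ :=
    { toFun := fun φ => φ.toEuclideanSchwartz
      map_add' := fun _ _ => rfl
      map_smul' := fun _ _ => rfl }
  have hF : ∀ (φ : 𝓓(Q, ℂ)) (v : SpaceTime n),
      ∂_{(WithLp.toLp 2 v : EuclideanSpaceTime n)} (F φ) = F (∂_{v} φ) :=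
    TestFunction.lineDerivOp_toEuclideanSchwartz
  change F (conjugatedWaveOp Q ω lam ψ) = conjugatedWaveAdjoint ω lam (F ψ)
  simp only [conjugatedWaveOp, conjugatedWaveAdjoint, waveOp, hF, map_add, map_sub, map_smul,
    map_sum]

theorem contDiff_cexp_clm (l : SpaceTime n →L[ℝ] ℂ) :
    ContDiff ℝ (⊤ : ℕ∞) fun z => Complex.exp (l z) := l.contDiff.cexp

theorem fderiv_cexp_clm (l : SpaceTime n →L[ℝ] ℂ) (z v : SpaceTime n) :
    fderiv ℝ (fun z => Complex.exp (l z)) z v = l v * Complex.exp (l z) := by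
  rw [l.hasFDerivAt.cexp.fderiv]
  simp [mul_comm]

theorem lineDerivOp_smoothMul_cexp (l : SpaceTime n →L[ℝ] ℂ) (φ : 𝓓(Q, ℂ)) (v : SpaceTime n) :
    ∂_{v} (φ.smoothMul _ (contDiff_cexp_clm l)) =
      (∂_{v} φ).smoothMul _ (contDiff_cexp_clm l) +
        l v • φ.smoothMul _ (contDiff_cexp_clm l) := by
  ext z
  rw [TestFunction.lineDerivOp_smoothMul_apply, fderiv_cexp_clm]
  change _ = Complex.exp (l z) * (∂_{v} φ) z + l v * (Complex.exp (l z) * φ z)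
  ring

/-- Conjugation of the wave operator with `exp (-lam (t + x ⬝ ω))`. -/
theorem conjugatedWaveOp_smoothMul_cexp_apply {ω : Space n} (hω : ‖ω‖ = 1) {lam : ℝ}
    {l : SpaceTime n →L[ℝ] ℂ} (hl0 : l (coordDir none) = -lam)
    (hl : ∀ i, l (coordDir (some i)) = -lam * ω i) (φ : 𝓓(Q, ℂ)) (z : SpaceTime n) :
    conjugatedWaveOp Q ω lam (φ.smoothMul _ (contDiff_cexp_clm l)) z =
      Complex.exp (l z) * waveOp Q φ z := by
  have h1 : ∀ (φ : 𝓓(Q, ℂ)) v, testEval z (∂_{v} (φ.smoothMul _ (contDiff_cexp_clm l))) =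
      Complex.exp (l z) * (testEval z (∂_{v} φ) + l v * testEval z φ) := fun φ v => by
    rw [lineDerivOp_smoothMul_cexp, map_add, map_smul]
    change Complex.exp (l z) * (∂_{v} φ) z + l v * (Complex.exp (l z) * φ z) =
      Complex.exp (l z) * ((∂_{v} φ) z + l v * φ z)
    ring
  have h2 : ∀ (φ : 𝓓(Q, ℂ)) v, testEval z (∂_{v} (∂_{v} (φ.smoothMul _ (contDiff_cexp_clm l)))) =
      Complex.exp (l z) * (testEval z (∂_{v} (∂_{v} φ)) + 2 * l v * testEval z (∂_{v} φ) +
        l v ^ 2 * testEval z φ) := fun φ v => by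
    rw [lineDerivOp_smoothMul_cexp, LineDeriv.lineDerivOp_add, LineDeriv.lineDerivOp_smul,
      map_add, map_smul, h1, h1, smul_eq_mul]
    ring
  -- The phase is light-like: this identity cancels all the terms in `lam ^ 2`.
  have h3 : ∑ i, (ω i : ℂ) ^ 2 = 1 := by
    have := EuclideanSpace.real_norm_sq_eq ω
    rw [hω] at this
    exact_mod_cast this.symm.trans (one_pow 2)
  change testEval z (conjugatedWaveOp Q ω lam (φ.smoothMul _ (contDiff_cexp_clm l))) =
    Complex.exp (l z) * testEval z (waveOp Q φ)
  simp only [conjugatedWaveOp, waveOp, map_add, map_sub, map_smul, map_sum, h1, h2, hl0, hl,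
    smul_eq_mul]
  have e1 : ∑ i, Complex.exp (l z) *
      (testEval z (∂_{(coordDir (some i) : SpaceTime n)}
        (∂_{(coordDir (some i) : SpaceTime n)} φ)) +
        2 * (-lam * ω i) * testEval z (∂_{(coordDir (some i) : SpaceTime n)} φ) +
        (-lam * ω i) ^ 2 * testEval z φ) =
      Complex.exp (l z) * (∑ i, testEval z (∂_{(coordDir (some i) : SpaceTime n)}
        (∂_{(coordDir (some i) : SpaceTime n)} φ)) -
        2 * lam * ∑ i, ω i * testEval z (∂_{(coordDir (some i) : SpaceTime n)} φ) +
        lam ^ 2 * testEval z φ * ∑ i, (ω i : ℂ) ^ 2) := by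
    rw [← Finset.mul_sum]
    congr 1
    rw [Finset.mul_sum, Finset.mul_sum, ← Finset.sum_sub_distrib, ← Finset.sum_add_distrib]
    exact Finset.sum_congr rfl fun i _ => by ring
  have e2 : ∑ i, (ω i : ℂ) * (Complex.exp (l z) *
      (testEval z (∂_{(coordDir (some i) : SpaceTime n)} φ) + -lam * ω i * testEval z φ)) =
      Complex.exp (l z) * (∑ i, ω i * testEval z (∂_{(coordDir (some i) : SpaceTime n)} φ) -
        lam * testEval z φ * ∑ i, (ω i : ℂ) ^ 2) := by
    rw [Finset.mul_sum (a := _ * _), mul_sub, Finset.mul_sum, Finset.mul_sum,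
      ← Finset.sum_sub_distrib]
    exact Finset.sum_congr rfl fun i _ => by ring
  rw [e1, e2, h3]
  ring

theorem hasWeakDeriv_cexp_clm (l : SpaceTime n →L[ℝ] ℂ) (v : SpaceTime n) :
    HasWeakDeriv Q v (fun z => Complex.exp (l z)) (fun z => l v * Complex.exp (l z)) :=
  (hasWeakDeriv_one.smooth_mul (contDiff_cexp_clm l)).congr (by simp)
    (by simp [fderiv_cexp_clm])

/-- Plane waves whose frequency is orthogonal to `(1, -ω)` are eigenfunctions of
`□ - 2 lam (∂_t - ω ⬝ ∇)`. -/
theorem integral_cexp_mul_conjugatedWaveOp {ω : Space n} {lam : ℝ} {l : SpaceTime n →L[ℝ] ℂ}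
    (hl : l (coordDir none) = ∑ i, ω i * l (coordDir (some i))) (ψ : 𝓓(Q, ℂ)) :
    ∫ z in Q, Complex.exp (l z) * conjugatedWaveOp Q ω lam ψ z =
      (l (coordDir none) ^ 2 - ∑ i, l (coordDir (some i)) ^ 2) *
        ∫ z in Q, Complex.exp (l z) * ψ z := by
  have hint : LocallyIntegrableOn (fun z => Complex.exp (l z)) Q :=
    (hasWeakDeriv_cexp_clm l (0 : SpaceTime n)).1
  let I : 𝓓(Q, ℂ) →ₗ[ℂ] ℂ :=
    { toFun := fun φ => ∫ z in Q, Complex.exp (l z) * φ z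
      map_add' := fun a b => by
        rw [← integral_add (hint.integrable_mul_testFunction a).integrableOn
          (hint.integrable_mul_testFunction b).integrableOn]
        exact integral_congr_ae (.of_forall fun z => mul_add _ _ _)
      map_smul' := fun c a => by
        rw [RingHom.id_apply, smul_eq_mul, ← integral_const_mul]
        exact integral_congr_ae (.of_forall fun z => mul_left_comm _ c _) }
  have hI : ∀ φ v, I (∂_{v} φ) = -(l v * I φ) := fun φ v => by
    change ∫ z in Q, Complex.exp (l z) * (∂_{v} φ) z = -(l v * ∫ z in Q, Complex.exp (l z) * φ z)
    rw [(hasWeakDeriv_cexp_clm l v).2.2 φ, ← integral_const_mul]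
    congr 1
    exact integral_congr_ae (.of_forall fun z => mul_assoc _ _ _)
  change I (conjugatedWaveOp Q ω lam ψ) = _ * I ψ
  simp only [conjugatedWaveOp, waveOp, map_add, map_sub, map_smul, map_sum, hI, smul_eq_mul]
  have e1 : ∑ i, -(l (coordDir (some i)) * -(l (coordDir (some i)) * I ψ)) =
      (∑ i, l (coordDir (some i)) ^ 2) * I ψ := by
    rw [Finset.sum_mul]
    exact Finset.sum_congr rfl fun i _ => by ring
  have e2 : ∑ i, (ω i : ℂ) * -(l (coordDir (some i)) * I ψ) =
      -((∑ i, ω i * l (coordDir (some i))) * I ψ) := by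
    rw [Finset.sum_mul, ← Finset.sum_neg_distrib]
    exact Finset.sum_congr rfl fun i _ => by ring
  rw [e1, e2, ← hl]
  ring

end ConjugatedWaveOperator

/-! ### The equation of the remainder and the assembly of the solution -/

section Construction

variable {n : ℕ}

theorem isBounded_spaceTimeCylinder {T : ℝ} {Ω : TopologicalSpace.Opens (Space n)}
    (hΩ : Bornology.IsBounded (Ω : Set (Space n))) :
    Bornology.IsBounded (spaceTimeCylinder T Ω : Set (SpaceTime n)) :=
  (Metric.isBounded_Ioo 0 T).prod hΩ

/-- The linear form `-lam (t + x ⬝ ω)`. -/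
noncomputable def lightPhase (ω : Space n) (lam : ℝ) : SpaceTime n →L[ℝ] ℂ :=
  Complex.ofRealCLM.comp (-lam • (ContinuousLinearMap.fst ℝ ℝ (Space n) +
    (innerSL ℝ ω).comp (ContinuousLinearMap.snd ℝ ℝ (Space n))))

theorem lightPhase_apply (ω : Space n) (lam : ℝ) (z : SpaceTime n) :
    lightPhase ω lam z = (-lam * (z.1 + inner ℝ z.2 ω) : ℝ) := by
  simp [lightPhase, real_inner_comm]
  ring

/-- The linear form `-i ξ ⬝ (t, x)`. -/
noncomputable def wavePhase (ξ : SpaceTime n) : SpaceTime n →L[ℝ] ℂ :=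
  (-Complex.I) • Complex.ofRealCLM.comp (ξ.1 • ContinuousLinearMap.fst ℝ ℝ (Space n) +
    (innerSL ℝ ξ.2).comp (ContinuousLinearMap.snd ℝ ℝ (Space n)))

theorem wavePhase_apply (ξ z : SpaceTime n) :
    wavePhase ξ z = -Complex.I * ((ξ.1 * z.1 + inner ℝ ξ.2 z.2 : ℝ) : ℂ) := by
  simp [wavePhase]
  ring

variable {ω : Space n} {lam T : ℝ} {ξ : SpaceTime n}

theorem lightPhase_coordDir_none : lightPhase ω lam (coordDir none) = -lam := by
  simp [lightPhase_apply, coordDir]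

theorem lightPhase_coordDir_some (i : Fin n) :
    lightPhase ω lam (coordDir (some i)) = -lam * ω i := by
  simp [lightPhase_apply, coordDir, EuclideanSpace.inner_single_left]

theorem wavePhase_coordDir_none : wavePhase ξ (coordDir none) = -Complex.I * ξ.1 := by
  simp [wavePhase_apply, coordDir]

theorem wavePhase_coordDir_some (i : Fin n) :
    wavePhase ξ (coordDir (some i)) = -Complex.I * ξ.2 i := by
  simp [wavePhase_apply, coordDir, EuclideanSpace.inner_single_right]

theorem wavePhase_coordDir_none_eq_sum (h : ξ.1 - inner ℝ ξ.2 ω = 0) :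
    wavePhase ξ (coordDir none) = ∑ i, ω i * wavePhase ξ (coordDir (some i)) := by
  rw [wavePhase_coordDir_none, sub_eq_zero.1 h]
  simp only [wavePhase_coordDir_some, PiLp.inner_apply, Complex.ofReal_sum, Finset.mul_sum]
  refine Finset.sum_congr rfl fun i _ => ?_
  simp
  ring

/-- The value of the symbol of `□` at the frequency `ξ`. -/
noncomputable def waveEigenvalue (ξ : SpaceTime n) : ℂ :=
  wavePhase ξ (coordDir none) ^ 2 - ∑ i, wavePhase ξ (coordDir (some i)) ^ 2

variable {Q : TopologicalSpace.Opens (SpaceTime n)}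

/-- If `f = -(□ + q) e^{-iξ⬝z} - q w` on `Q`, where `w` solves
`□ w - 2 lam (∂_t - ω ⬝ ∇) w = f`, then `e^{-lam (t + x⬝ω)} (e^{-iξ⬝z} + w)` solves
`□ u + q u = 0`. -/
theorem isWeakSolution_of_remainder (hω : ‖ω‖ = 1) (hξ : ξ.1 - inner ℝ ξ.2 ω = 0)
    {q : SpaceTime n → ℝ} {w f : SpaceTime n → ℂ} (hw : LocallyIntegrableOn w Q)
    (hf : LocallyIntegrableOn f Q)
    (hfw : ∀ᵐ z ∂volume.restrict (Q : Set (SpaceTime n)),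
      f z = -(waveEigenvalue ξ + q z) * Complex.exp (wavePhase ξ z) - q z * w z)
    (hweak : ∀ ψ : 𝓓(Q, ℂ), ∫ z in Q, w z * conjugatedWaveOp Q ω lam ψ z = ∫ z in Q, f z * ψ z) :
    IsWeakSolution Q q
      fun z => Complex.exp (lightPhase ω lam z) * (Complex.exp (wavePhase ξ z) + w z) := by
  intro φ
  set ψ := φ.smoothMul _ (contDiff_cexp_clm (lightPhase ω lam)) with hψ
  have hE : LocallyIntegrableOn (fun z => Complex.exp (wavePhase ξ z)) Q :=
    (hasWeakDeriv_cexp_clm (wavePhase ξ) (0 : SpaceTime n)).1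
  -- With the exponential weight absorbed into `ψ`, the equation for `u` becomes that of `exp
  -- (wavePhase ξ z) + w` tested against `ψ`; the potential is eliminated through `hfw`.
  have e : ∀ᵐ z ∂volume.restrict (Q : Set (SpaceTime n)),
      Complex.exp (lightPhase ω lam z) * (Complex.exp (wavePhase ξ z) + w z) *
        (waveOp Q φ z + (q z : ℂ) * φ z) =
      (Complex.exp (wavePhase ξ z) * conjugatedWaveOp Q ω lam ψ z +
        w z * conjugatedWaveOp Q ω lam ψ z) -
      (waveEigenvalue ξ * (Complex.exp (wavePhase ξ z) * ψ z) + f z * ψ z) := by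
    filter_upwards [hfw] with z hz
    rw [hψ, conjugatedWaveOp_smoothMul_cexp_apply hω lightPhase_coordDir_none
      lightPhase_coordDir_some, TestFunction.smoothMul_apply, hz]
    ring
  have i1 := (hE.integrable_mul_testFunction (conjugatedWaveOp Q ω lam ψ)).integrableOn (s := Q)
  have i2 := (hw.integrable_mul_testFunction (conjugatedWaveOp Q ω lam ψ)).integrableOn (s := Q)
  have i3 := ((hE.integrable_mul_testFunction ψ).const_mul (waveEigenvalue ξ)).integrableOn (s := Q)
  have i4 := (hf.integrable_mul_testFunction ψ).integrableOn (s := Q)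
  rw [integral_congr_ae e]
  refine (integral_sub (i1.add i2) (i3.add i4)).trans ?_
  refine (congrArg₂ (· - ·) (integral_add i1 i2) (integral_add i3 i4)).trans ?_
  rw [integral_cexp_mul_conjugatedWaveOp (wavePhase_coordDir_none_eq_sum hξ), hweak,
    integral_const_mul, waveEigenvalue]
  ring

/-- Solvability of the equation of the remainder. -/
theorem exists_remainder (hω : ‖ω‖ = 1) (hT : 0 < T) {Ω : TopologicalSpace.Opens (Space n)}
    (hΩ : Bornology.IsBounded (Ω : Set (Space n))) (ξ : SpaceTime n) {q : SpaceTime n → ℝ}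
    {M : ℝ≥0} (hq : MemLp q ∞ (volume.restrict (spaceTimeCylinder T Ω)))
    (hqM : eLpNorm q ∞ (volume.restrict (spaceTimeCylinder T Ω)) ≤ M) (hlam : 1 ≤ lam)
    (hlamM : 2 * M * T ≤ lam) :
    ∃ w f : SpaceTime n → ℂ, MemH1 (spaceTimeCylinder T Ω) w ∧
      LocallyIntegrableOn f (spaceTimeCylinder T Ω) ∧
      (∀ᵐ z ∂volume.restrict (spaceTimeCylinder T Ω),
        f z = -(waveEigenvalue ξ + q z) * Complex.exp (wavePhase ξ z) - q z * w z) ∧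
      (∀ ψ : 𝓓(spaceTimeCylinder T Ω, ℂ),
        ∫ z in spaceTimeCylinder T Ω, w z * conjugatedWaveOp _ ω lam ψ z =
          ∫ z in spaceTimeCylinder T Ω, f z * ψ z) ∧
      normL2 (spaceTimeCylinder T Ω) w ≤ ENNReal.ofReal (T * lam⁻¹ *
        (2 * ((‖waveEigenvalue ξ‖ + M) * (eLpNorm (fun z => Complex.exp (wavePhase ξ z)) 2
          (volume.restrict (spaceTimeCylinder T Ω))).toReal))) ∧
      ∀ j, normL2WeakDeriv (spaceTimeCylinder T Ω) (coordDir j) w ≤ ENNReal.ofReal ((1 + 2 * T) *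
        (2 * ((‖waveEigenvalue ξ‖ + M) * (eLpNorm (fun z => Complex.exp (wavePhase ξ z)) 2
          (volume.restrict (spaceTimeCylinder T Ω))).toReal))) := by
  set Q := spaceTimeCylinder T Ω
  have hQ : Bornology.IsBounded (Q : Set (SpaceTime n)) := isBounded_spaceTimeCylinder hΩ
  have hlam0 : 0 < lam := by linarith
  obtain ⟨σ, hσ, hσB, hσ'⟩ := exists_waveMultiplier_lp (n := n) hω hlam hT.le
  have hE : MemLp (fun z => Complex.exp (wavePhase ξ z)) 2 (volume.restrict (Q : Set _)) := by
    simpa using ((memH1_one hQ).smooth_mul hQ (contDiff_cexp_clm (wavePhase ξ))).1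
  obtain ⟨e, he, heN⟩ := exists_lp_ae_eq_indicator hE
  obtain ⟨p, hp, hpN⟩ := exists_lp_ae_eq_indicator (Q := Q) hq.ofReal (h := fun z => (q z : ℂ))
  have hpM : ‖p‖ ≤ M := by
    rw [hpN]
    refine ENNReal.toReal_le_coe_of_le_coe ?_
    refine le_trans (le_of_eq ?_) hqM
    exact eLpNorm_congr_norm_ae (.of_forall fun z => Complex.norm_real _)
  -- The gain `T / lam` of the multiplier beats the potential as soon as `lam ≥ 2 M T`.
  have hpσ : ‖p‖ * ‖σ‖ ≤ 1 / 2 := by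
    calc ‖p‖ * ‖σ‖ ≤ M * (T * lam⁻¹) := by gcongr
      _ ≤ 1 / 2 := by
        rw [← mul_assoc, ← div_eq_mul_inv, div_le_iff₀ hlam0]
        linarith
  -- Both `e` and `p` are extensions by zero, so the fixed point `g = F - p W` vanishes outside `Q`,
  -- although `W` need not.
  set F : Lp ℂ 2 (volume : Measure (EuclideanSpaceTime n)) :=
    -(waveEigenvalue ξ • e + (p • e : Lp ℂ 2 (volume : Measure (EuclideanSpaceTime n))))
  have hFN : ‖F‖ ≤ (‖waveEigenvalue ξ‖ + M) * ‖e‖ := by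
    rw [norm_neg, add_mul]
    refine (norm_add_le _ _).trans (add_le_add (norm_smul_le _ _) ((Lp.norm_smul_le _ _).trans ?_))
    gcongr
  obtain ⟨g, hg, hgN⟩ := exists_fixedPoint_lpMultiplier hpσ F
  have hgN' : ‖g‖ ≤ 2 * ((‖waveEigenvalue ξ‖ + M) * ‖e‖) := by linarith
  set W := lpMultiplier σ g
  have hgae : ∀ᵐ z, g z = (Q : Set (SpaceTime n)).indicator (fun z =>
      -(waveEigenvalue ξ + q z) * Complex.exp (wavePhase ξ z) - q z * W (WithLp.toLp 2 z))
      (WithLp.ofLp z) := by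
    have e1 : (g : EuclideanSpaceTime n → ℂ) =
        (F - (p • W : Lp ℂ 2 (volume : Measure (EuclideanSpaceTime n))) :
          Lp ℂ 2 (volume : Measure (EuclideanSpaceTime n))) := by
      conv_lhs => rw [hg]
    rw [e1]
    filter_upwards [he, hp,
      Lp.coeFn_sub F (p • W : Lp ℂ 2 (volume : Measure (EuclideanSpaceTime n))),
      Lp.coeFn_neg (waveEigenvalue ξ • e +
        (p • e : Lp ℂ 2 (volume : Measure (EuclideanSpaceTime n)))),
      Lp.coeFn_add (waveEigenvalue ξ • e)
        (p • e : Lp ℂ 2 (volume : Measure (EuclideanSpaceTime n))),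
      Lp.coeFn_smul (waveEigenvalue ξ) e, Lp.coeFn_lpSMul (r := 2) p e,
      Lp.coeFn_lpSMul (r := 2) p W] with z h1 h2 h3 h4 h5 h6 h7 h8
    rw [h3, Pi.sub_apply, h4, Pi.neg_apply, h5, Pi.add_apply, h6, h7, h8, Pi.smul_apply,
      Pi.smul_apply', Pi.smul_apply', h1, h2]
    by_cases hz : WithLp.ofLp z ∈ (Q : Set (SpaceTime n))
    · simp only [Set.indicator_of_mem hz, smul_eq_mul, WithLp.toLp_ofLp]
      ring
    · simp [Set.indicator_of_notMem hz]
  refine ⟨fun z => W (WithLp.toLp 2 z), fun z => g (WithLp.toLp 2 z),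
    ⟨memLp_restrict_comp_toLp W, fun j => ?_⟩,
    (memLp_restrict_comp_toLp g).locallyIntegrableOn_opens, ?_, fun ψ => ?_, ?_, fun j => ?_⟩
  · obtain ⟨σ', h, -⟩ := hσ' j
    exact ⟨_, memLp_restrict_comp_toLp _, hasWeakDeriv_lpMultiplier h g⟩
  · refine (ae_restrict_iff' Q.isOpen.measurableSet).2 ?_
    have hpres := WithLp.volume_preserving_toLp ℝ (Space n)
    filter_upwards [hpres.quasiMeasurePreserving.ae hgae] with z h1 hz
    rw [h1, Set.indicator_of_mem (by exact hz)]
  · rw [← integral_toEuclideanSchwartz_mul, ← integral_toEuclideanSchwartz_mul,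
      toEuclideanSchwartz_conjugatedWaveOp]
    -- The two support conditions come from the two ends of `(0, T)`: `ψ` vanishes for `t < 0`, and
    -- `g` for `t ≥ T`.
    refine integral_conjugatedWaveAdjoint_mul_lpMultiplier hω hlam hT.le hσ (fun z hz => ?_) ?_
    · exact ψ.eq_zero_of_notMem fun h => hz.not_gt h.1.1
    · filter_upwards [hgae] with z h1 hz
      rw [h1, Set.indicator_of_notMem fun h => hz h.1.2]
  · refine (normL2_comp_toLp_le W).trans (ENNReal.ofReal_le_ofReal ?_)
    rw [← heN]
    refine (norm_lpMultiplier_le σ g).trans ?_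
    gcongr
  · obtain ⟨σ', h, hB⟩ := hσ' j
    rw [normL2WeakDeriv_eq (hasWeakDeriv_lpMultiplier h g)]
    refine (normL2_comp_toLp_le _).trans (ENNReal.ofReal_le_ofReal ?_)
    rw [← heN]
    refine (norm_lpMultiplier_le σ' g).trans ?_
    gcongr

end Construction

/-! ### The main theorem -/

theorem proposition3p2 (n : ℕ) (hn : 2 ≤ n) (Ω : TopologicalSpace.Opens (Space n))
    (hΩ : IsC2BoundedDomain Ω) (T : ℝ) (hT : 0 < T) (ξ : SpaceTime n) (M : ℝ≥0) :
    ∃ C lam₀ : ℝ, 0 < C ∧ 1 < lam₀ ∧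
      ∀ ω : Space n, ‖ω‖ = 1 → ξ.1 - inner ℝ ξ.2 ω = 0 →
      ∀ q : SpaceTime n → ℝ, MemLp q ∞ (volume.restrict (spaceTimeCylinder T Ω)) →
        eLpNorm q ∞ (volume.restrict (spaceTimeCylinder T Ω)) ≤ M →
      ∀ lam : ℝ, lam₀ ≤ lam →
      ∃ u w : SpaceTime n → ℂ,
        MemH1 (spaceTimeCylinder T Ω) u ∧
        IsWeakSolution (spaceTimeCylinder T Ω) q u ∧
        MemH1 (spaceTimeCylinder T Ω) w ∧
        (∀ z ∈ spaceTimeCylinder T Ω,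
          u z = (Real.exp (-lam * (z.1 + inner ℝ z.2 ω)) : ℂ) *
            (Complex.exp (-Complex.I * ((ξ.1 * z.1 + inner ℝ ξ.2 z.2 : ℝ) : ℂ)) + w z)) ∧
        normL2 (spaceTimeCylinder T Ω) w ≤ ENNReal.ofReal (C * lam⁻¹) ∧
        normH1 (spaceTimeCylinder T Ω) w ≤ ENNReal.ofReal C := by
  -- `K` bounds the `L²` norm of the source `g`; it does not involve `ω`, `q` or `lam`.
  set K : ℝ := 2 * ((‖waveEigenvalue ξ‖ + M) * (eLpNorm (fun z => Complex.exp (wavePhase ξ z)) 2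
    (volume.restrict (spaceTimeCylinder T Ω))).toReal) with hK
  have hK0 : 0 ≤ K := by positivity
  have hD : 0 ≤ (1 + 2 * T) * K := by positivity
  -- The factor `n + 2` counts the terms of the `H¹` norm, and `+ 1` keeps the constant positive
  -- even if `K = 0`. The threshold gives both the contraction and `lam ≥ 1`.
  refine ⟨(n + 2) * ((1 + 2 * T) * K) + 1, 2 * M * T + 2, by positivity, ?_, ?_⟩
  · have : 0 ≤ 2 * M * T := by positivity
    linarith
  intro ω hω hξ q hq hqM lam hlam
  have hMT : 0 ≤ 2 * M * T := by positivity
  have hlam1 : 1 ≤ lam := by linarith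
  obtain ⟨w, f, hw, hf, hfw, hweak, hL2, hder⟩ :=
    exists_remainder hω hT hΩ.isBounded ξ hq hqM hlam1 (by linarith)
  rw [← hK] at hL2
  have hQ := isBounded_spaceTimeCylinder (T := T) hΩ.isBounded
  have hE : MemH1 (spaceTimeCylinder T Ω) (fun z => Complex.exp (wavePhase ξ z)) := by
    simpa using (memH1_one hQ).smooth_mul hQ (contDiff_cexp_clm (wavePhase ξ))
  refine ⟨_, w, (hE.add hw).smooth_mul hQ (contDiff_cexp_clm (lightPhase ω lam)),
    isWeakSolution_of_remainder hω hξ hw.1.locallyIntegrableOn_opens hf hfw hweak, hw,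
    fun z _ => ?_, hL2.trans (ENNReal.ofReal_le_ofReal ?_), ?_⟩
  · rw [lightPhase_apply, wavePhase_apply, Complex.ofReal_exp]
  · have hTK : T * K ≤ (1 + 2 * T) * K := by nlinarith
    have hnD : 0 ≤ n * ((1 + 2 * T) * K) := by positivity
    calc T * lam⁻¹ * K = T * K * lam⁻¹ := by ring
      _ ≤ ((n + 2) * ((1 + 2 * T) * K) + 1) * lam⁻¹ := by
        refine mul_le_mul_of_nonneg_right ?_ (by positivity)
        linarith
  · have hlam' : T * lam⁻¹ ≤ 1 + 2 * T := by
      have : lam⁻¹ ≤ 1 := inv_le_one_of_one_le₀ hlam1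
      nlinarith
    refine (normH1_le (hL2.trans (ENNReal.ofReal_le_ofReal
      (mul_le_mul_of_nonneg_right hlam' hK0))) hder).trans ?_
    have hn2 : ((n : ℝ≥0∞) + 2) = ENNReal.ofReal (n + 2) := by
      rw [ENNReal.ofReal_add (by positivity) (by norm_num)]
      simp
    rw [hn2, ← ENNReal.ofReal_mul (by positivity)]
    exact ENNReal.ofReal_le_ofReal (by linarith)
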